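/- Let $\mathbb M$ be the space of simple point measures on $[0,1]$ (finite sums of unit point masses at distinct points), with the $\sigma$-algebra generated by the maps $\nu\mapsto\nu(B)$, $B\subseteq[0,1]$ Borel. For $\lambda>\mu>0$, a thinning from $\lambda$ to $\mu$ on $[0,1]$ is a measurable function $f:\mathbb M\to\mathbb M$ such that, if $\Pi$ is a homogeneous Poisson point process of intensity $\lambda$ on $[0,1]$, then $f(\Pi)$ is a homogeneous Poisson point process of intensity $\mu$ on $[0,1]$, and almost surely every point of $f(\Pi)$ is a point of $\Pi$. For $\mu>0$ let \[ \lambda_c(\mu):=\inf\{\lambda>\mu:\ \text{there is a thinning from } \lambda \text{ to } \mu \text{ on } [0,1]\}. \] Then for every $\mu>0$ the set on the right is non-empty and $\lambda_c(\mu)\le\mu+1$. Moreover, $\lambda_c(\mu)\ge\mu+1-o(1)$ as $\mu\to\infty$; that is, there is a function $r$ with $r(\mu)\to0$ as $\mu\to\infty$ such that $\lambda_c(\mu)\ge\mu+1-r(\mu)$ for all sufficiently large $\mu$. -/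

import Mathlib

open MeasureTheory ProbabilityTheory Filter Asymptotics

noncomputable section

/-- The space of simple point measures on `[0,1]`: finite sums of unit masses at distinct points.
As a subtype of `Measure unitInterval` it carries the σ-algebra generated by the
evaluations `ν ↦ ν B`, for `B` a Borel set. -/
abbrev SimplePointMeasure : Type :=
  {ν : Measure unitInterval // ∃ A : Finset unitInterval, ν = ∑ x ∈ A, Measure.dirac x}

/-- The set of points of a simple point measure. -/
def SimplePointMeasure.points (ν : SimplePointMeasure) : Set unitInterval :=
  {x | ν.1 {x} = 1}

/-- `N` is a homogeneous Poisson point process of intensity `lam` on `[0,1]` (a random simple point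
measure defined on `(Ω, P)`): the number of points in a Borel set `B` is Poisson with mean `lam`
times the Lebesgue measure of `B`, and the numbers of points in disjoint Borel sets are
independent. It is meant for `lam ≥ 0`. -/
structure IsPoissonProcess {Ω : Type*} [MeasurableSpace Ω] (P : Measure Ω)
    (N : Ω → SimplePointMeasure) (lam : ℝ) : Prop where
  measurable : Measurable N
  map_count : ∀ B : Set unitInterval, MeasurableSet B →
    P.map (fun ω => (N ω).1 B) =
      (poissonMeasure (lam * volume.real B).toNNReal).map (Nat.cast : ℕ → ENNReal)
  indep_count : ∀ (n : ℕ) (B : Fin n → Set unitInterval), (∀ i, MeasurableSet (B i)) →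
    Pairwise (Function.onFun Disjoint B) → iIndepFun (fun i ω => (N ω).1 (B i)) P

/-- `f` is a (deterministic, Poisson) thinning on `[0,1]` from `lam` to `mu`. -/
def IsThinning (f : SimplePointMeasure → SimplePointMeasure) (lam mu : ℝ) : Prop :=
  Measurable f ∧
    ∀ (Ω : Type) [MeasurableSpace Ω] (P : Measure Ω) [IsProbabilityMeasure P]
      (N : Ω → SimplePointMeasure), IsPoissonProcess P N lam →
        IsPoissonProcess P (fun ω => f (N ω)) mu ∧
          ∀ᵐ ω ∂P, (f (N ω)).points ⊆ (N ω).points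

/-- The intensities `lam > mu` from which there is a thinning to `mu` on `[0,1]`. -/
def thinnableIntensities (mu : ℝ) : Set ℝ :=
  {lam | mu < lam ∧ ∃ f, IsThinning f lam mu}

/-- The critical intensity `λ_c(μ)`. -/
def criticalIntensity (mu : ℝ) : ℝ := sInf (thinnableIntensities mu)

end

/-! Write `N_t` for a Poisson variable of mean `t` and `w_t(n)` for its weights. Given its number of
points, a Poisson process consists of independent uniform points, so everything reduces to the
counts, except that a deterministic rule must draw its randomness from the positions.

Lower bound. Suppose `w_lam(k) > w_mu(k)`, and let `A` be the set of `k`-point configurations from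
which `f` deletes nothing. Being fixed by `f`, almost all of `A` maps into `A`, so the mass of `A`
at intensity `lam` is at most its mass at `mu`. These masses are `w_lam(k)` and `w_mu(k)` times the
same uniform probability, so `A` is null. Hence almost every `k`-point configuration loses a point,
and `P(N_lam ≤ k) ≤ P(N_mu < k)` (`IsThinning.sum_poissonWeight_le`). Since `P(N_t ≤ k)` has
derivative `-w_t(k)` in `t`, this says `w_mu(k) ≤ (lam - mu) w_c(k)` for some `c` between `mu` and
`lam`. If `lam ≤ mu + 1` and `k = ⌈lam⌉₊`, the two weights differ at most by a factor `exp (2 /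
mu)`, so `lam - mu ≥ exp (-(2 / mu))`.

Upper bound. Let `k` be the last count that is at least as likely at `mu` as at `mu + 1`. With at
most `k` points, keep everything. With more, delete a point chosen through the fine digits of the
positions. The same digits yield a uniform variable independent of the surviving points
(`uniformLaw_removePoint_residual`), and this variable decides how many points to keep. The counts
can be coupled in this way if `P(N_(mu+1) ≤ n) ≤ P(N_mu < n)` for all `n > k`
(`exists_poisson_coupling`). By the mean value theorem this is `w_mu(n) ≤ w_c(n)`, which follows
from log-concavity of `w_t(n)` in `t`. -/

/-! ### Poisson weights as functions of the mean -/

/-- The weight of `n` under the Poisson distribution of mean `t`. -/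
noncomputable def poissonWeight (t : ℝ) (n : ℕ) : ℝ := Real.exp (-t) * t ^ n / n.factorial

lemma poissonWeight_pos {t : ℝ} (ht : 0 < t) (n : ℕ) : 0 < poissonWeight t n := by
  unfold poissonWeight; positivity

lemma poissonWeight_succ (t : ℝ) (n : ℕ) :
    poissonWeight t (n + 1) = poissonWeight t n * (t / (n + 1)) := by
  unfold poissonWeight
  rw [Nat.factorial_succ]; push_cast
  field_simp
  ring

lemma hasSum_poissonWeight (t : ℝ) : HasSum (poissonWeight t) 1 := by
  have h := (NormedSpace.expSeries_div_hasSum_exp (𝔸 := ℝ) t).mul_left (Real.exp (-t))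
  rw [← Real.exp_eq_exp_ℝ, ← Real.exp_add, neg_add_cancel, Real.exp_zero] at h
  simp only [← mul_div_assoc] at h
  exact h

/-- The derivative of the weight of `n + 1` is the difference of the weights of `n` and `n + 1`, so
the sum telescopes. -/
lemma hasDerivAt_sum_poissonWeight (n : ℕ) (t : ℝ) :
    HasDerivAt (fun s => ∑ i ∈ Finset.range (n + 1), poissonWeight s i) (-poissonWeight t n) t := by
  have hexp : HasDerivAt (fun s : ℝ => Real.exp (-s)) (-Real.exp (-t)) t := by
    simpa using (hasDerivAt_neg t).exp
  induction n with
  | zero => simpa [poissonWeight] using hexp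
  | succ n ih =>
    simp only [Finset.sum_range_succ _ (n + 1)]
    have h : HasDerivAt (fun s => poissonWeight s (n + 1))
        (poissonWeight t n - poissonWeight t (n + 1)) t := by
      unfold poissonWeight
      refine ((hexp.mul (hasDerivAt_pow (n + 1) t)).div_const
        ((n + 1).factorial : ℝ)).congr_deriv ?_
      rw [Nat.factorial_succ]; push_cast
      field_simp
      ring_nf
    exact (ih.add h).congr_deriv (by ring)

lemma exists_sum_poissonWeight_eq {a b : ℝ} (hab : a < b) (n : ℕ) :
    ∃ c ∈ Set.Ioo a b, ∑ i ∈ Finset.range (n + 1), poissonWeight b i =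
      ∑ i ∈ Finset.range (n + 1), poissonWeight a i - (b - a) * poissonWeight c n := by
  obtain ⟨c, hc, h⟩ := exists_hasDerivAt_eq_slope
    (fun s => ∑ i ∈ Finset.range (n + 1), poissonWeight s i) _ hab
    (fun x _ => (hasDerivAt_sum_poissonWeight n x).continuousAt.continuousWithinAt)
    (fun x _ => hasDerivAt_sum_poissonWeight n x)
  refine ⟨c, hc, ?_⟩
  rw [eq_div_iff (sub_pos.2 hab).ne'] at h
  linarith

lemma poissonWeight_eq_exp {t : ℝ} (ht : 0 < t) (n : ℕ) :
    poissonWeight t n = Real.exp (n * Real.log t - t) / n.factorial := by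
  rw [poissonWeight, sub_eq_neg_add, Real.exp_add, Real.exp_nat_mul, Real.exp_log ht]

lemma poissonWeight_le_iff {a b : ℝ} (ha : 0 < a) (hb : 0 < b) (n : ℕ) :
    poissonWeight a n ≤ poissonWeight b n ↔ n * Real.log a - a ≤ n * Real.log b - b := by
  rw [poissonWeight_eq_exp ha, poissonWeight_eq_exp hb,
    div_le_div_iff_of_pos_right (by positivity), Real.exp_le_exp]

/-- The logarithm of the weight, `n log t - t` up to a constant, is concave in `t`, so on an
interval it is at least the smaller endpoint value. -/
lemma poissonWeight_le_of_mem_Ioo {a b c : ℝ} (ha : 0 < a) (hc : c ∈ Set.Ioo a b) {n : ℕ}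
    (h : poissonWeight a n ≤ poissonWeight b n) : poissonWeight a n ≤ poissonWeight c n := by
  have hc0 := ha.trans hc.1
  have hb0 := hc0.trans hc.2
  rw [poissonWeight_le_iff ha hb0] at h
  rw [poissonWeight_le_iff ha hc0]
  have h1 := strictConcaveOn_log_Ioi.concaveOn.slope_anti_adjacent (Set.mem_Ioi.2 ha)
    (Set.mem_Ioi.2 hb0) hc.1 hc.2
  rw [div_le_div_iff₀ (by linarith [hc.2]) (by linarith [hc.1])] at h1
  have h2 := mul_le_mul_of_nonneg_left h1 (Nat.cast_nonneg (α := ℝ) n)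
  nlinarith [hc.1, hc.2]

lemma poissonWeight_lt_of_le {a b : ℝ} (ha : 0 < a) (hab : a < b) {n : ℕ} (hn : b ≤ n) :
    poissonWeight a n < poissonWeight b n := by
  have hb := ha.trans hab
  rw [← not_le, poissonWeight_le_iff hb ha, not_le]
  have h1 := Real.log_lt_sub_one_of_pos (div_pos ha hb)
    (by rw [Ne, div_eq_one_iff_eq hb.ne']; exact hab.ne)
  rw [Real.log_div ha.ne' hb.ne'] at h1
  have h2 : a / b ≤ 1 := (div_le_one hb).2 hab.le
  have h3 : b * (a / b) = a := by field_simp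
  have h4 : 0 < (n : ℝ) := hb.trans_le hn
  nlinarith [mul_lt_mul_of_pos_left h1 h4, mul_nonneg (sub_nonneg.2 hn) (sub_nonneg.2 h2)]

/-- By `log x ≤ x - 1`, the logarithm of the ratio is at most `(n - a) (c - a) / a`, where `n - a ≤
2` and `0 < c - a ≤ 1`. -/
lemma poissonWeight_le_exp_mul {a c : ℝ} (ha : 0 < a) (hac : a < c) (hc : c ≤ a + 1) {n : ℕ}
    (hn : n ≤ a + 2) :
    poissonWeight c n ≤ Real.exp (2 / a) * poissonWeight a n := by
  have hc0 := ha.trans hac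
  rw [poissonWeight_eq_exp hc0, poissonWeight_eq_exp ha, ← mul_div_assoc, ← Real.exp_add]
  refine div_le_div_of_nonneg_right (Real.exp_le_exp.2 ?_) (by positivity)
  have h1 := Real.log_le_sub_one_of_pos (div_pos hc0 ha)
  rw [Real.log_div hc0.ne' ha.ne'] at h1
  have h2 : n * (c / a - 1) - (c - a) ≤ 2 / a := by
    have : n * (c / a - 1) - (c - a) = (n - a) * (c - a) / a := by field_simp
    rw [this]
    exact div_le_div_of_nonneg_right (by nlinarith) ha.le
  nlinarith [mul_le_mul_of_nonneg_left h1 (Nat.cast_nonneg (α := ℝ) n)]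

/-- The ratio of the weights is a constant times `(b / a) ^ n`: it increases in `n`, is below one at
zero and eventually exceeds one. -/
lemma exists_poissonWeight_crossing {a b : ℝ} (ha : 0 < a) (hab : a < b) :
    ∃ k : ℕ, (∀ n ≤ k, poissonWeight b n ≤ poissonWeight a n) ∧
      ∀ n > k, poissonWeight a n ≤ poissonWeight b n := by
  classical
  have hb := ha.trans hab
  obtain ⟨N, hN⟩ := exists_nat_ge b
  have hex : ∃ n, poissonWeight a n < poissonWeight b n := ⟨N, poissonWeight_lt_of_le ha hab hN⟩
  have h0 : Nat.find hex ≠ 0 := by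
    intro h
    have := Nat.find_spec hex
    rw [h] at this
    simp only [poissonWeight, pow_zero, mul_one, Nat.factorial_zero, Nat.cast_one, div_one,
      Real.exp_lt_exp] at this
    linarith
  refine ⟨Nat.find hex - 1, fun n hn => not_lt.1 (Nat.find_min hex (by omega)), fun n hn => ?_⟩
  have hle : Nat.find hex ≤ n := by omega
  refine le_of_lt ?_
  induction n, hle using Nat.le_induction with
  | base => exact Nat.find_spec hex
  | succ n hmn ih =>
    rw [poissonWeight_succ, poissonWeight_succ]
    have := ih (by omega)
    have h2 := poissonWeight_pos ha n
    gcongr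

lemma tendsto_sum_poissonWeight (t : ℝ) :
    Tendsto (fun n => ∑ i ∈ Finset.range n, poissonWeight t i) atTop (nhds 1) :=
  (hasSum_poissonWeight t).tendsto_sum_nat

/-! ### Coupling two Poisson laws by quantiles -/

lemma volume_Ico_inter_preimage_affine {a p : ℝ} (hp : 0 < p) (S : Set ℝ) :
    ENNReal.ofReal p * volume (Set.Ico 0 1 ∩ (fun v => a + v * p) ⁻¹' S) =
      volume (Set.Ico a (a + p) ∩ S) := by
  have h : Set.Ico 0 1 ∩ (fun v => a + v * p) ⁻¹' S =
      (fun v => v * p) ⁻¹' ((fun v => a + v) ⁻¹' (Set.Ico a (a + p) ∩ S)) := by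
    ext v
    simp only [Set.mem_inter_iff, Set.mem_Ico, Set.mem_preimage, le_add_iff_nonneg_right,
      add_lt_add_iff_left, mul_nonneg_iff_of_pos_right hp]
    rw [mul_lt_iff_lt_one_left hp]
  rw [h, Real.volume_preimage_mul_right hp.ne', measure_preimage_add, ← mul_assoc,
    ← ENNReal.ofReal_mul hp.le, abs_of_pos (by positivity), mul_inv_cancel₀ hp.ne',
    ENNReal.ofReal_one, one_mul]

lemma measurable_nat_sInf {α : Type*} [MeasurableSpace α] {S : ℕ → Set α}
    (hS : ∀ m, MeasurableSet (S m)) : Measurable fun a => sInf {m | a ∈ S m} := by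
  refine measurable_to_countable' fun j => ?_
  by_cases hj : j = 0
  -- The convention `sInf ∅ = 0` puts the points lying in no `S m` into the fibre of zero.
  · have : (fun a => sInf {m | a ∈ S m}) ⁻¹' {j} = S 0 ∪ (⋃ m, S m)ᶜ := by
      ext u
      simp [hj, Nat.sInf_eq_zero, Set.eq_empty_iff_forall_notMem]
    rw [this]
    exact (hS 0).union (MeasurableSet.iUnion hS).compl
  · have : (fun a => sInf {m | a ∈ S m}) ⁻¹' {j} = S j ∩ ⋂ m : Fin j, (S m)ᶜ := by
      ext u
      simp only [Set.mem_preimage, Set.mem_singleton_iff, Set.mem_inter_iff, Set.mem_iInter,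
        Set.mem_compl_iff]
      constructor
      · intro h
        refine ⟨?_, fun m => Nat.notMem_of_lt_sInf (s := {m | u ∈ S m}) (by omega)⟩
        rw [← h]
        exact Nat.sInf_mem (s := {m | u ∈ S m}) (Nat.nonempty_of_sInf_eq_succ
          (k := j - 1) (by omega))
      · rintro ⟨h1, h2⟩
        refine le_antisymm (Nat.sInf_le h1) (le_csInf ⟨j, h1⟩ fun m hm => ?_)
        by_contra! h
        exact h2 ⟨m, h⟩ hm
    rw [this]
    exact (hS j).inter (MeasurableSet.iInter fun m => (hS _).compl)

/-- The generalized inverse of the sequence `Q`. -/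
noncomputable def quantile (Q : ℕ → ℝ) (u : ℝ) : ℕ := sInf {m | u < Q (m + 1)}

lemma quantile_eq_iff {Q : ℕ → ℝ} (hQ : Monotone Q) {u : ℝ} (h0 : Q 0 ≤ u) (h1 : ∃ m, u < Q m)
    (j : ℕ) : quantile Q u = j ↔ u ∈ Set.Ico (Q j) (Q (j + 1)) := by
  have hne : {m | u < Q (m + 1)}.Nonempty := by
    obtain ⟨m, hm⟩ := h1
    exact ⟨m, hm.trans_le (hQ (by omega))⟩
  constructor
  · rintro rfl
    refine ⟨?_, Nat.sInf_mem hne⟩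
    rcases h : quantile Q u with _ | i
    · exact h0
    · have : i ∉ {m | u < Q (m + 1)} := Nat.notMem_of_lt_sInf (by unfold quantile at h; omega)
      exact not_lt.1 this
  · rintro ⟨h2, h3⟩
    refine le_antisymm (Nat.sInf_le h3) (le_csInf hne fun m hm => ?_)
    by_contra! h
    exact absurd (hm.trans_le (hQ h)) (not_lt.2 h2)

lemma measurable_quantile (Q : ℕ → ℝ) : Measurable (quantile Q) :=
  measurable_nat_sInf fun _ => measurableSet_Iio

/-- A coupling of the Poisson distributions of means `b` and `a`, with second coordinate equal to
the first one up to `k`, and strictly smaller from `k + 1` on. -/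
lemma exists_poisson_coupling {a b : ℝ} (ha : 0 < a) (hb : 0 < b) {k : ℕ}
    (hk : ∀ n ≤ k, poissonWeight b n ≤ poissonWeight a n)
    (hF : ∀ n > k, ∑ i ∈ Finset.range (n + 1), poissonWeight b i ≤
      ∑ i ∈ Finset.range n, poissonWeight a i) :
    ∃ m : ℕ → ℝ → ℕ, (∀ n, Measurable (m n)) ∧
      (∀ n > k, ∀ v ∈ Set.Ico (0 : ℝ) 1, m n v < n) ∧
      ∀ j, ENNReal.ofReal (poissonWeight a j) =
        (if j ≤ k then ENNReal.ofReal (poissonWeight b j) else 0) +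
          ∑' i, ENNReal.ofReal (poissonWeight b (k + 1 + i)) *
            volume (Set.Ico (0 : ℝ) 1 ∩ m (k + 1 + i) ⁻¹' {j}) := by
  set F : ℕ → ℝ := fun n => ∑ i ∈ Finset.range n, poissonWeight b i with hFdef
  -- `q` is the part of the target law not yet covered by the counts up to `k` that are kept. `Q`
  -- starts at `F (k + 1)`, so that its steps, of lengths `q`, subdivide `[F (k + 1), 1)`.
  set q : ℕ → ℝ := fun i => poissonWeight a i - if i ≤ k then poissonWeight b i else 0 with hq
  set Q : ℕ → ℝ := fun m => F (k + 1) + ∑ i ∈ Finset.range m, q i with hQdef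
  have hFs : ∀ n, F (n + 1) = F n + poissonWeight b n := fun n => Finset.sum_range_succ _ _
  have hQs : ∀ n, Q (n + 1) = Q n + q n := fun n => by
    simp only [hQdef, Finset.sum_range_succ]; ring
  have hq0 : ∀ i, 0 ≤ q i := fun i => by
    simp only [hq]
    split_ifs with h
    · exact sub_nonneg.2 (hk i h)
    · simpa using (poissonWeight_pos ha i).le
  have hFmono : Monotone F := monotone_nat_of_le_succ fun n => by
    rw [hFs]; linarith [poissonWeight_pos hb n]
  have hQmono : Monotone Q := monotone_nat_of_le_succ fun n => by rw [hQs]; linarith [hq0 n]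
  have hQ0 : Q 0 = F (k + 1) := by simp [hQdef]
  have hQeq : ∀ m > k, Q m = ∑ i ∈ Finset.range m, poissonWeight a i := by
    intro m hm
    simp only [hQdef, hq, Finset.sum_sub_distrib]
    rw [← Finset.sum_filter]
    have : (Finset.range m).filter (· ≤ k) = Finset.range (k + 1) := by
      ext i; simp; omega
    rw [this]
    simp [hFdef]
  have hQ1 : Tendsto Q atTop (nhds 1) := by
    refine (tendsto_sum_poissonWeight a).congr' ?_
    filter_upwards [eventually_gt_atTop k] with m hm using (hQeq m hm).symm
  have hF1 : Tendsto F atTop (nhds 1) := tendsto_sum_poissonWeight b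
  have hQle : ∀ m, Q m ≤ 1 := fun m => hQmono.ge_of_tendsto hQ1 m
  -- This is where `hF` enters: the source interval `[F n, F (n + 1))` lies to the left of `Q n`, so
  -- only targets below `n` meet it.
  have hlt : ∀ n > k, ∀ u < F (n + 1), u < Q n := fun n hn u hu =>
    hu.trans_le ((hF n hn).trans (hQeq n hn).ge)
  -- `v` selects a uniform position in the source interval of `n`; the new count is the index of the
  -- target interval that contains it.
  refine ⟨fun n v => quantile Q (F n + v * poissonWeight b n), fun n =>
    (measurable_quantile Q).comp (by fun_prop), ?_, ?_⟩
  · intro n hn v hv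
    have hu : F n + v * poissonWeight b n < Q n := hlt n hn _ (by
      rw [hFs]; nlinarith [poissonWeight_pos hb n, hv.2])
    obtain ⟨n, rfl⟩ : ∃ i, n = i + 1 := ⟨n - 1, by omega⟩
    exact Nat.lt_succ_of_le (Nat.sInf_le hu)
  · intro j
    have hterm : ∀ i, ENNReal.ofReal (poissonWeight b (k + 1 + i)) *
        volume (Set.Ico (0 : ℝ) 1 ∩ (fun v => quantile Q (F (k + 1 + i) +
          v * poissonWeight b (k + 1 + i))) ⁻¹' {j}) =
        volume (Set.Ico (F (k + 1 + i)) (F (k + 1 + (i + 1))) ∩ Set.Ico (Q j) (Q (j + 1))) := by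
      intro i
      have := volume_Ico_inter_preimage_affine (a := F (k + 1 + i))
        (poissonWeight_pos hb (k + 1 + i)) (quantile Q ⁻¹' {j})
      rw [← hFs] at this
      rw [← Set.preimage_comp] at this
      refine this.trans (congrArg _ ?_)
      ext u
      refine and_congr_right fun hu => ?_
      refine quantile_eq_iff hQmono ?_ ⟨_, hlt (k + 1 + i) (by omega) u hu.2⟩ j
      rw [hQ0]
      exact (hFmono (by omega)).trans hu.1
    simp only [hterm]
    have hshift : Monotone fun i => F (k + 1 + i) := fun i i' h => hFmono (by omega)
    rw [← measure_iUnion]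
    · have : ⋃ i, Set.Ico (F (k + 1 + i)) (F (k + 1 + (i + 1))) ∩ Set.Ico (Q j) (Q (j + 1)) =
          Set.Ico (Q j) (Q (j + 1)) := by
        rw [← Set.iUnion_inter, Set.inter_eq_right]
        intro u hu
        have hu0 : F (k + 1) ≤ u := hQ0 ▸ (hQmono (Nat.zero_le j)).trans hu.1
        have hu1 : u < 1 := hu.2.trans_le (hQle _)
        have h1 : ∃ i, u < F (k + 1 + (i + 1)) := by
          obtain ⟨n, hn⟩ := (hF1.eventually (lt_mem_nhds hu1)).exists
          exact ⟨n, hn.trans_le (hFmono (by omega))⟩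
        have h2 := (quantile_eq_iff (Q := fun i => F (k + 1 + i)) hshift hu0
          (h1.imp' (· + 1) fun _ h => h) _).1 rfl
        exact Set.mem_iUnion.2 ⟨_, h2⟩
      rw [this, Real.volume_Ico, hQs, add_sub_cancel_left]
      simp only [hq]
      split_ifs with h
      · rw [← ENNReal.ofReal_add (poissonWeight_pos hb j).le (sub_nonneg.2 (hk j h))]
        congr 1; ring
      · simp
    · intro i i' h
      exact (hshift.pairwise_disjoint_on_Ico_succ h).mono Set.inter_subset_left
        Set.inter_subset_left
    · exact fun i => measurableSet_Ico.inter measurableSet_Ico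

/-! ### Uniqueness of the law of a Poisson process -/

lemma SimplePointMeasure.measurable_apply {B : Set unitInterval} (hB : MeasurableSet B) :
    Measurable fun ν : SimplePointMeasure => ν.1 B :=
  (Measure.measurable_coe hB).comp measurable_subtype_coe

lemma SimplePointMeasure.measurable_of_apply {Ω : Type*} [MeasurableSpace Ω]
    {N : Ω → SimplePointMeasure}
    (h : ∀ B, MeasurableSet B → Measurable fun ω => (N ω).1 B) : Measurable N :=
  (Measure.measurable_of_measurable_coe _ h).subtype_mk

lemma SimplePointMeasure.isFiniteMeasure (ν : SimplePointMeasure) : IsFiniteMeasure ν.1 := by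
  obtain ⟨A, hA⟩ := ν.2
  rw [hA]; infer_instance

lemma SimplePointMeasure.apply_ne_top (ν : SimplePointMeasure) (B : Set unitInterval) :
    ν.1 B ≠ ⊤ :=
  haveI := ν.isFiniteMeasure
  measure_ne_top _ _

lemma isPoissonProcess_map_iff {Ω : Type*} [MeasurableSpace Ω] {P : Measure Ω}
    [IsProbabilityMeasure P] {N : Ω → SimplePointMeasure} (hN : Measurable N) {t : ℝ} :
    IsPoissonProcess (P.map N) id t ↔ IsPoissonProcess P N t := by
  have key : ∀ B : Set unitInterval, MeasurableSet B →
      (P.map N).map (fun ν : SimplePointMeasure => ν.1 B) = P.map fun ω => (N ω).1 B :=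
    fun B hB => Measure.map_map (SimplePointMeasure.measurable_apply hB) hN
  have := Measure.isProbabilityMeasure_map hN.aemeasurable (μ := P)
  have key2 : ∀ (n : ℕ) (B : Fin n → Set unitInterval), (∀ i, MeasurableSet (B i)) →
      (iIndepFun (fun i (ν : SimplePointMeasure) => ν.1 (B i)) (P.map N) ↔
        iIndepFun (fun i ω => (N ω).1 (B i)) P) := by
    intro n B hB
    have h1 := fun i => SimplePointMeasure.measurable_apply (hB i)
    rw [iIndepFun_iff_map_fun_eq_pi_map fun i => (h1 i).aemeasurable,
      iIndepFun_iff_map_fun_eq_pi_map (f := fun i ω => (N ω).1 (B i))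
        fun i => ((h1 i).comp hN).aemeasurable,
      Measure.map_map (measurable_pi_lambda _ h1) hN]
    simp only [key _ (hB _)]
    rfl
  constructor
  · intro h
    exact ⟨hN, fun B hB => (key B hB).symm.trans (h.map_count B hB),
      fun n B hB hd => (key2 n B hB).1 (h.indep_count n B hB hd)⟩
  · intro h
    exact ⟨measurable_id, fun B hB => (key B hB).trans (h.map_count B hB),
      fun n B hB hd => (key2 n B hB).2 (h.indep_count n B hB hd)⟩

/-- The joint law of the numbers of points in finitely many sets is that of an explicit function
of the numbers of points in their atoms. -/
lemma IsPoissonProcess.map_family_eq {P Q : Measure SimplePointMeasure} [IsProbabilityMeasure P]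
    [IsProbabilityMeasure Q] {t : ℝ} (hP : IsPoissonProcess P id t) (hQ : IsPoissonProcess Q id t)
    {ι : Type*} [Fintype ι] (B : ι → Set unitInterval) (hB : ∀ i, MeasurableSet (B i)) :
    P.map (fun ν i => ν.1 (B i)) = Q.map (fun ν i => ν.1 (B i)) := by
  classical
  -- The atoms of the algebra generated by the sets `B i` are disjoint, so their counts are
  -- independent with known laws.
  let A : (ι → Bool) → Set unitInterval := fun g => {x | ∀ i, x ∈ B i ↔ g i = true}
  have hA : ∀ g, MeasurableSet (A g) := by
    intro g
    have : A g = ⋂ i, if g i = true then B i else (B i)ᶜ := by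
      ext x
      simp only [A, Set.mem_ofPred_eq, Set.mem_iInter]
      refine forall_congr' fun i => ?_
      by_cases h : g i = true <;> simp [h]
    rw [this]
    refine MeasurableSet.iInter fun i => ?_
    split_ifs
    · exact hB i
    · exact (hB i).compl
  have hdisj : Pairwise (Function.onFun Disjoint A) := by
    intro g g' h
    refine Set.disjoint_left.2 fun x hx hx' => h (funext fun i => ?_)
    have := (hx i).symm.trans (hx' i)
    exact Bool.eq_iff_iff.2 this
  let e : Fin (Fintype.card (ι → Bool)) ≃ (ι → Bool) := (Fintype.equivFin _).symm
  have joint : ∀ {R : Measure SimplePointMeasure} [IsProbabilityMeasure R],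
      IsPoissonProcess R id t → R.map (fun ν j => ν.1 (A (e j))) =
        Measure.pi fun j => (poissonMeasure (t * volume.real (A (e j))).toNNReal).map
          (Nat.cast : ℕ → ENNReal) := by
    intro R _ hR
    have h := hR.indep_count _ (fun j => A (e j)) (fun j => hA _)
      fun i j hij => hdisj (e.injective.ne hij)
    refine ((iIndepFun_iff_map_fun_eq_pi_map
      fun j => (SimplePointMeasure.measurable_apply (hA _)).aemeasurable).1 h).trans
        (congrArg _ (funext fun j => hR.map_count _ (hA _)))
  let Φ : (Fin (Fintype.card (ι → Bool)) → ENNReal) → ι → ENNReal :=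
    fun c i => ∑ j, if e j i = true then c j else 0
  have hΦ : Measurable Φ := by
    refine measurable_pi_lambda _ fun i => Finset.measurable_sum _ fun j _ => ?_
    split_ifs
    · exact measurable_pi_apply j
    · exact measurable_const
  have hfac : (fun (ν : SimplePointMeasure) i => ν.1 (B i)) =
      Φ ∘ fun ν j => ν.1 (A (e j)) := by
    funext ν i
    have hBi : B i = ⋃ g ∈ Finset.univ.filter (fun g : ι → Bool => g i = true), A g := by
      ext x
      simp only [Finset.mem_filter, Finset.mem_univ, true_and, Set.mem_iUnion, exists_prop]
      constructor
      · exact fun hx => ⟨fun i => decide (x ∈ B i), by simpa using hx, fun i => by simp⟩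
      · rintro ⟨g, hg, hx⟩
        exact (hx i).2 hg
    conv_lhs => rw [hBi, measure_biUnion_finset (fun g _ g' _ h => hdisj h) fun g _ => hA g]
    rw [Finset.sum_filter]
    exact (e.sum_comp fun g => if g i = true then ν.1 (A g) else 0).symm
  have hm : Measurable fun (ν : SimplePointMeasure) j => ν.1 (A (e j)) :=
    measurable_pi_lambda _ fun j => SimplePointMeasure.measurable_apply (hA _)
  rw [hfac, ← Measure.map_map hΦ hm, ← Measure.map_map hΦ hm, joint hP, joint hQ]

/-- The law of a Poisson process is determined by its intensity. -/
lemma IsPoissonProcess.law_unique {P Q : Measure SimplePointMeasure} [IsProbabilityMeasure P]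
    [IsProbabilityMeasure Q] {t : ℝ} (hP : IsPoissonProcess P id t)
    (hQ : IsPoissonProcess Q id t) : P = Q := by
  let Φ : SimplePointMeasure → {B : Set unitInterval // MeasurableSet B} → ENNReal :=
    fun ν B => ν.1 B.1
  have hΦ : Measurable Φ :=
    measurable_pi_lambda _ fun B => SimplePointMeasure.measurable_apply B.2
  have hcomap : (inferInstance : MeasurableSpace SimplePointMeasure) ≤
      MeasurableSpace.comap Φ MeasurableSpace.pi := by
    have : @Measurable _ _ (MeasurableSpace.comap Φ MeasurableSpace.pi) _
        (fun ν : SimplePointMeasure => ν) := by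
      let _ := MeasurableSpace.comap Φ MeasurableSpace.pi
      refine SimplePointMeasure.measurable_of_apply fun B hB => ?_
      exact (measurable_pi_apply (⟨B, hB⟩ : {B : Set unitInterval // MeasurableSet B})).comp
        (comap_measurable Φ)
    intro s hs
    exact this hs
  have hmap : P.map Φ = Q.map Φ := by
    have := Measure.isProbabilityMeasure_map hΦ.aemeasurable (μ := P)
    -- A finite measure on a product is determined by its finite-dimensional marginals.
    refine IsProjectiveLimit.unique (P := fun J => (P.map Φ).map J.restrict)
      (fun J => rfl) fun J => ?_
    have hJ : Measurable (J.restrict (π := fun _ : {B : Set unitInterval // MeasurableSet B} =>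
      ENNReal)) := Finset.measurable_restrict J
    change (Q.map Φ).map J.restrict = (P.map Φ).map J.restrict
    rw [Measure.map_map hJ hΦ, Measure.map_map hJ hΦ]
    exact hQ.map_family_eq hP (fun B : J => B.1.1) fun B => B.1.2
  ext s hs
  obtain ⟨T, hT, rfl⟩ := hcomap s hs
  rw [← Measure.map_apply hΦ hT, ← Measure.map_apply hΦ hT, hmap]

/-! ### The Poisson process as a mixture of uniform samples -/

open Classical in
/-- The simple point measure with atoms `x i`, if these are distinct, and zero otherwise. -/
noncomputable def SimplePointMeasure.ofPoints {n : ℕ} (x : Fin n → unitInterval) :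
    SimplePointMeasure :=
  if h : Function.Injective x then
    ⟨∑ i, Measure.dirac (x i), Finset.univ.image x, by
      rw [Finset.sum_image fun i _ j _ hij => h hij]⟩
  else ⟨0, ∅, by simp⟩

namespace SimplePointMeasure

lemma ofPoints_val {n : ℕ} {x : Fin n → unitInterval} (h : Function.Injective x) :
    (ofPoints x).1 = ∑ i, Measure.dirac (x i) := by
  simp [ofPoints, h]

lemma ofPoints_apply {n : ℕ} {x : Fin n → unitInterval} (h : Function.Injective x)
    (B : Set unitInterval) : (ofPoints x).1 B = ∑ i, B.indicator 1 (x i) := by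
  simp [ofPoints_val h, Measure.finsetSum_apply]

lemma measurableSet_injective (n : ℕ) :
    MeasurableSet {x : Fin n → unitInterval | Function.Injective x} := by
  have : {x : Fin n → unitInterval | Function.Injective x} =
      ⋂ i, ⋂ j, ⋂ _ : i ≠ j, {x | x i = x j}ᶜ := by
    ext x
    simp only [Set.mem_ofPred_eq, Set.mem_iInter, Set.mem_compl_iff, Function.Injective]
    exact forall₂_congr fun i j => not_imp_not.symm
  rw [this]
  exact MeasurableSet.iInter fun i => MeasurableSet.iInter fun j => MeasurableSet.iInter fun _ =>
    (measurableSet_eq_fun (measurable_pi_apply i) (measurable_pi_apply j)).compl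

lemma measurable_ofPoints (n : ℕ) : Measurable (ofPoints (n := n)) := by
  classical
  refine measurable_of_apply fun B hB => ?_
  have : (fun x : Fin n → unitInterval => (ofPoints x).1 B) =
      {x | Function.Injective x}.indicator fun x => ∑ i, B.indicator 1 (x i) := by
    funext x
    by_cases h : Function.Injective x
    · rw [ofPoints_apply h, Set.indicator_of_mem (by exact h)]
    · rw [Set.indicator_of_notMem (by exact h)]
      simp [ofPoints, h]
  rw [this]
  refine Measurable.indicator ?_ (measurableSet_injective n)
  exact Finset.measurable_sum _ fun i _ =>
    (measurable_one.indicator hB).comp (measurable_pi_apply i)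

end SimplePointMeasure

/-- By Fubini, two given coordinates coincide with probability zero. Hence the default value in
`ofPoints` is never relevant. -/
lemma ae_injective_unitInterval (n : ℕ) :
    ∀ᵐ x : Fin n → unitInterval, Function.Injective x := by
  have h : ∀ i j : Fin n, i ≠ j → ∀ᵐ x : Fin n → unitInterval, x i ≠ x j := by
    intro i j hij
    obtain ⟨n, rfl⟩ : ∃ m, n = m + 1 := ⟨n - 1, by have := i.pos; omega⟩
    obtain ⟨j, rfl⟩ := Fin.exists_succAbove_eq hij.symm
    have hmp := (volume_preserving_piFinSuccAbove (fun _ : Fin (n + 1) => unitInterval) i)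
    have hae : ∀ᵐ p : unitInterval × (Fin n → unitInterval), p.1 ≠ p.2 j := by
      have hms : MeasurableSet {p : unitInterval × (Fin n → unitInterval) | p.1 = p.2 j} :=
        measurableSet_eq_fun measurable_fst ((measurable_pi_apply j).comp measurable_snd)
      rw [ae_iff]
      simp only [not_not, Measure.volume_eq_prod]
      rw [Measure.prod_apply_symm hms]
      simp only [lintegral_eq_zero_iff (measurable_measure_prodMk_right hms)]
      exact Eventually.of_forall fun y => by simp
    exact hmp.quasiMeasurePreserving.ae hae
  have h' : ∀ᵐ x : Fin n → unitInterval, ∀ i j : Fin n, i ≠ j → x i ≠ x j := by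
    refine ae_all_iff.2 fun i => ae_all_iff.2 fun j => ?_
    by_cases hij : i = j
    · simp [hij]
    · filter_upwards [h i j hij] with x hx _ using hx
  filter_upwards [h'] with x hx i j hij
  by_contra hne
  exact hx i j hne hij

/-- The law of `n` independent uniform points. -/
noncomputable def uniformLaw (n : ℕ) : Measure SimplePointMeasure :=
  (volume : Measure (Fin n → unitInterval)).map SimplePointMeasure.ofPoints

instance (n : ℕ) : IsProbabilityMeasure (uniformLaw n) :=
  Measure.isProbabilityMeasure_map (SimplePointMeasure.measurable_ofPoints n).aemeasurable

lemma ae_uniformLaw {n : ℕ} {p : SimplePointMeasure → Prop}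
    (hp : MeasurableSet {ν | p ν})
    (h : ∀ x : Fin n → unitInterval, Function.Injective x → p (SimplePointMeasure.ofPoints x)) :
    ∀ᵐ ν ∂uniformLaw n, p ν := by
  rw [uniformLaw, ae_map_iff (SimplePointMeasure.measurable_ofPoints n).aemeasurable hp]
  filter_upwards [ae_injective_unitInterval n] with x hx using h x hx

lemma ae_uniformLaw_univ (n : ℕ) : ∀ᵐ ν ∂uniformLaw n, ν.1 Set.univ = (n : ENNReal) := by
  refine ae_uniformLaw ?_ fun x hx => by simp [SimplePointMeasure.ofPoints_apply hx]
  exact SimplePointMeasure.measurable_apply MeasurableSet.univ (measurableSet_singleton _)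

/-- The law of a Poisson process: a Poisson number of independent uniform points. -/
noncomputable def poissonLaw (t : ℝ) : Measure SimplePointMeasure :=
  Measure.sum fun n => ENNReal.ofReal (poissonWeight t n) • uniformLaw n

lemma poissonLaw_apply (t : ℝ) {S : Set SimplePointMeasure} (hS : MeasurableSet S) :
    poissonLaw t S = ∑' n, ENNReal.ofReal (poissonWeight t n) * uniformLaw n S := by
  simp [poissonLaw, Measure.sum_apply _ hS]

lemma isProbabilityMeasure_poissonLaw {t : ℝ} (ht : 0 < t) :
    IsProbabilityMeasure (poissonLaw t) := by
  constructor
  rw [poissonLaw_apply t MeasurableSet.univ]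
  simp only [measure_univ, mul_one]
  rw [← ENNReal.ofReal_tsum_of_nonneg (fun n => (poissonWeight_pos ht n).le)
    (hasSum_poissonWeight t).summable, (hasSum_poissonWeight t).tsum_eq, ENNReal.ofReal_one]

open Complex in
-- At most one of the disjoint sets contains `x`, so the exponential is affine in the indicators and
-- can be integrated termwise.
lemma cexp_sum_indicator {k : ℕ} {B : Fin k → Set unitInterval}
    (hd : Pairwise (Function.onFun Disjoint B)) (s : Fin k → ℝ) (x : unitInterval) :
    cexp ((∑ j, (B j).indicator 1 x * s j : ℝ) * I) =
      1 + ∑ j, (B j).indicator (fun _ => cexp (s j * I) - 1) x := by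
  by_cases h : ∃ j, x ∈ B j
  · obtain ⟨j, hj⟩ := h
    have hother : ∀ i, i ≠ j → x ∉ B i := fun i hij hi => Set.disjoint_left.1 (hd hij) hi hj
    rw [Finset.sum_eq_single j (fun i _ hij => by simp [hother i hij]) (by simp),
      Finset.sum_eq_single j (fun i _ hij => by simp [hother i hij]) (by simp)]
    simp [hj]
  · push Not at h
    simp [h]

lemma SimplePointMeasure.toReal_ofPoints_apply {n : ℕ} {x : Fin n → unitInterval}
    (h : Function.Injective x) (B : Set unitInterval) :
    ((ofPoints x).1 B).toReal = ∑ i, B.indicator 1 (x i) := by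
  rw [ofPoints_apply h, ENNReal.toReal_sum]
  · refine Finset.sum_congr rfl fun i _ => ?_
    by_cases hi : x i ∈ B <;> simp [hi]
  · intro i _
    by_cases hi : x i ∈ B <;> simp [hi]

open Complex in
lemma integral_cexp_uniformLaw {k : ℕ} {B : Fin k → Set unitInterval}
    (hB : ∀ j, MeasurableSet (B j)) (hd : Pairwise (Function.onFun Disjoint B)) (s : Fin k → ℝ)
    (n : ℕ) :
    ∫ ν, cexp ((∑ j, (ν.1 (B j)).toReal * s j : ℝ) * I) ∂uniformLaw n =
      (1 + ∑ j, volume.real (B j) * (cexp (s j * I) - 1)) ^ n := by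
  have hmeas : Measurable fun ν : SimplePointMeasure =>
      cexp ((∑ j, (ν.1 (B j)).toReal * s j : ℝ) * I) := by
    have := fun j => (SimplePointMeasure.measurable_apply (hB j)).ennreal_toReal
    fun_prop
  rw [uniformLaw, integral_map (SimplePointMeasure.measurable_ofPoints n).aemeasurable
    hmeas.aestronglyMeasurable]
  have hprod : ∀ᵐ x : Fin n → unitInterval,
      cexp ((∑ j, ((SimplePointMeasure.ofPoints x).1 (B j)).toReal * s j : ℝ) * I) =
        ∏ i, (1 + ∑ j, (B j).indicator (fun _ => cexp (s j * I) - 1) (x i)) := by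
    filter_upwards [ae_injective_unitInterval n] with x hx
    simp only [← cexp_sum_indicator hd, ← Complex.exp_sum, ← Finset.sum_mul, ← ofReal_sum,
      SimplePointMeasure.toReal_ofPoints_apply hx]
    rw [Finset.sum_comm]
    simp only [Finset.sum_mul]
  rw [integral_congr_ae hprod,
    integral_fintype_prod_volume_eq_pow (fun y => 1 + ∑ j, (B j).indicator
      (fun _ => cexp (s j * I) - 1) y), Fintype.card_fin]
  congr 1
  have hint : ∀ j, Integrable ((B j).indicator fun _ => cexp (s j * I) - 1)
      (volume : Measure unitInterval) := fun j => (integrable_const _).indicator (hB j)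
  rw [integral_add (integrable_const _) (integrable_finsetSum _ fun j _ => hint j),
    integral_finsetSum _ fun j _ => hint j]
  simp [integral_indicator_const, hB]

open Complex in
-- Averaging the `n`-th powers over a Poisson `n` sums an exponential series. The result factors
-- over `j`, which gives the Poisson counts and their independence at once.
lemma integral_cexp_poissonLaw {t : ℝ} (ht : 0 < t) {k : ℕ} {B : Fin k → Set unitInterval}
    (hB : ∀ j, MeasurableSet (B j)) (hd : Pairwise (Function.onFun Disjoint B)) (s : Fin k → ℝ) :
    ∫ ν, cexp ((∑ j, (ν.1 (B j)).toReal * s j : ℝ) * I) ∂poissonLaw t =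
      ∏ j, cexp ((t * volume.real (B j)).toNNReal * (cexp (s j * I) - 1)) := by
  have := isProbabilityMeasure_poissonLaw ht
  have hmeas : Measurable fun ν : SimplePointMeasure =>
      cexp ((∑ j, (ν.1 (B j)).toReal * s j : ℝ) * I) := by
    have := fun j => (SimplePointMeasure.measurable_apply (hB j)).ennreal_toReal
    fun_prop
  have hint : Integrable (fun ν : SimplePointMeasure =>
      cexp ((∑ j, (ν.1 (B j)).toReal * s j : ℝ) * I)) (poissonLaw t) :=
    Integrable.of_bound hmeas.aestronglyMeasurable 1
      (Eventually.of_forall fun ν => (Complex.norm_exp_ofReal_mul_I _).le)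
  rw [poissonLaw, integral_sum_measure hint]
  simp only [integral_smul_measure, integral_cexp_uniformLaw hB hd,
    ENNReal.toReal_ofReal (poissonWeight_pos ht _).le]
  set z : ℂ := ∑ j, volume.real (B j) * (cexp (s j * I) - 1) with hz
  have hterm : ∀ n, poissonWeight t n • (1 + z) ^ n =
      cexp (-t) * ((t * (1 + z)) ^ n / n.factorial) := by
    intro n
    rw [Complex.real_smul, poissonWeight]
    push_cast
    rw [mul_pow]; ring
  simp only [hterm]
  rw [tsum_mul_left, (NormedSpace.expSeries_div_hasSum_exp (𝔸 := ℂ) (t * (1 + z))).tsum_eq,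
    ← Complex.exp_eq_exp_ℂ, ← Complex.exp_add, ← Complex.exp_sum]
  congr 1
  have h2 : ∀ j, (((t * volume.real (B j)).toNNReal : ℝ) : ℂ) = t * volume.real (B j) := by
    intro j
    rw [Real.coe_toNNReal _ (by positivity)]
    push_cast; rfl
  simp only [h2, mul_assoc, ← Finset.mul_sum, ← hz]
  ring

open Complex in
lemma isPoissonProcess_poissonLaw {t : ℝ} (ht : 0 < t) :
    IsPoissonProcess (poissonLaw t) id t := by
  have := isProbabilityMeasure_poissonLaw ht
  have hreal : ∀ {B : Set unitInterval}, MeasurableSet B →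
      Measurable fun ν : SimplePointMeasure => (ν.1 B).toReal :=
    fun hB => (SimplePointMeasure.measurable_apply hB).ennreal_toReal
  have hchar : ∀ {B : Set unitInterval}, MeasurableSet B → ∀ s : ℝ,
      charFun ((poissonLaw t).map fun ν => (ν.1 B).toReal) s =
        cexp ((t * volume.real B).toNNReal * (cexp (s * I) - 1)) := by
    intro B hB s
    rw [charFun_apply, integral_map (hreal hB).aemeasurable (by fun_prop)]
    have := integral_cexp_poissonLaw ht (B := fun _ : Fin 1 => B) (fun _ => hB)
      (Subsingleton.pairwise) (fun _ => s)
    simpa [Real.inner_apply, mul_comm] using this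
  refine ⟨measurable_id, fun B hB => ?_, fun n B hB hd => ?_⟩
  · have h : (poissonLaw t).map (fun ν => (ν.1 B).toReal) =
        (poissonMeasure (t * volume.real B).toNNReal).map (Nat.cast : ℕ → ℝ) := by
      have := Measure.isProbabilityMeasure_map (hreal hB).aemeasurable (μ := poissonLaw t)
      refine Measure.ext_of_charFun (funext fun s => ?_)
      rw [hchar hB, charFun_map_cast_poissonMeasure]
    -- Counts are finite, so nothing is lost in passing through real values.
    have h' := congrArg (Measure.map ENNReal.ofReal) h
    rw [Measure.map_map ENNReal.measurable_ofReal (hreal hB),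
      Measure.map_map ENNReal.measurable_ofReal .of_discrete] at h'
    convert h' using 2
    · funext ν
      exact (ENNReal.ofReal_toReal (ν.apply_ne_top B)).symm
    · funext i
      simp
  · have h : iIndepFun (fun i (ν : SimplePointMeasure) => (ν.1 (B i)).toReal) (poissonLaw t) := by
      rw [iIndepFun_iff_charFun_pi fun i => (hreal (hB i)).aemeasurable]
      intro s
      have hm : Measurable fun (ν : SimplePointMeasure) =>
          WithLp.toLp 2 fun i => (ν.1 (B i)).toReal := by
        have := fun i => hreal (hB i)
        fun_prop
      rw [charFun_apply, integral_map hm.aemeasurable (by fun_prop)]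
      simp only [hchar (hB _)]
      rw [← integral_cexp_poissonLaw ht hB hd]
      simp [PiLp.inner_apply, mul_comm]
    have h' := h.comp (fun _ => ENNReal.ofReal) fun _ => ENNReal.measurable_ofReal
    convert h' using 3 with i ν
    exact (ENNReal.ofReal_toReal (ν.apply_ne_top (B i))).symm

/-- Every Poisson process of intensity `t` has law `poissonLaw t`. -/
lemma isPoissonProcess_iff_map_eq {Ω : Type*} [MeasurableSpace Ω] {P : Measure Ω}
    [IsProbabilityMeasure P] {N : Ω → SimplePointMeasure} (hN : Measurable N) {t : ℝ}
    (ht : 0 < t) : IsPoissonProcess P N t ↔ P.map N = poissonLaw t := by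
  have := isProbabilityMeasure_poissonLaw ht
  have := Measure.isProbabilityMeasure_map hN.aemeasurable (μ := P)
  rw [← isPoissonProcess_map_iff hN]
  exact ⟨fun h => h.law_unique (isPoissonProcess_poissonLaw ht),
    fun h => h ▸ isPoissonProcess_poissonLaw ht⟩

/-! ### Uniform variables modulo one and their digits -/

lemma measurable_apply_countable {α β ι : Type*} [MeasurableSpace α] [MeasurableSpace β]
    [MeasurableSpace ι] [Countable ι] [MeasurableSingletonClass ι] {g : ι → α → β}
    (hg : ∀ i, Measurable (g i)) {f : α → ι} (hf : Measurable f) :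
    Measurable fun a => g (f a) a :=
  (measurable_from_prod_countable_right (f := fun p : ι × α => g p.1 p.2) hg).comp
    (hf.prodMk measurable_id)

/-- Translation modulo one preserves Lebesgue measure on `[0,1)`. -/
lemma volume_Ico_inter_preimage_fract_add (c : ℝ) (A : Set ℝ) :
    volume (Set.Ico (0 : ℝ) 1 ∩ {u | Int.fract (c + u) ∈ A}) = volume (Set.Ico (0 : ℝ) 1 ∩ A) := by
  wlog hc : c ∈ Set.Ico (0 : ℝ) 1 generalizing c
  · rw [← this (Int.fract c) ⟨Int.fract_nonneg c, Int.fract_lt_one c⟩]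
    congr 2
    ext u
    have : Int.fract (c + u) = Int.fract (Int.fract c + u) := by
      conv_lhs => rw [← Int.fract_add_floor c, add_right_comm, Int.fract_add_intCast]
    rw [Set.mem_ofPred_eq, this, Set.mem_ofPred_eq]
  -- The interval is cut at `1 - c`, where `c + u` wraps around; each piece is then translated.
  have h1 : Set.Ico (0 : ℝ) 1 ∩ {u | Int.fract (c + u) ∈ A} ∩ Set.Iio (1 - c) =
      (fun u => c + u) ⁻¹' (Set.Ico 0 1 ∩ A ∩ Set.Ici c) := by
    ext u
    simp only [Set.mem_inter_iff, Set.mem_Ico, Set.mem_Iio, Set.mem_preimage, Set.mem_Ici,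
      Set.mem_ofPred_eq]
    constructor
    · rintro ⟨⟨⟨h0, h1⟩, h2⟩, h3⟩
      rw [Int.fract_eq_self.2 ⟨by linarith [hc.1], by linarith⟩] at h2
      exact ⟨⟨⟨by linarith [hc.1], by linarith⟩, h2⟩, by linarith⟩
    · rintro ⟨⟨⟨h0, h1⟩, h2⟩, h3⟩
      rw [Int.fract_eq_self.2 ⟨by linarith [hc.1], by linarith⟩]
      exact ⟨⟨⟨by linarith, by linarith [hc.1]⟩, h2⟩, by linarith⟩
  have h2 : (Set.Ico (0 : ℝ) 1 ∩ {u | Int.fract (c + u) ∈ A}) \ Set.Iio (1 - c) =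
      (fun u => (c - 1) + u) ⁻¹' ((Set.Ico 0 1 ∩ A) \ Set.Ici c) := by
    ext u
    simp only [Set.mem_inter_iff, Set.mem_Ico, Set.mem_Iio, Set.mem_preimage, Set.mem_Ici,
      Set.mem_ofPred_eq, Set.mem_sdiff, not_lt, not_le]
    have hfr : 1 ≤ c + u → c + u < 2 → Int.fract (c + u) = c - 1 + u := by
      intro ha hb
      rw [← Int.fract_sub_one, Int.fract_eq_self.2 ⟨by linarith, by linarith⟩]
      ring
    constructor
    · rintro ⟨⟨⟨h0, h1⟩, h2⟩, h3⟩
      rw [hfr (by linarith) (by linarith [hc.2])] at h2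
      exact ⟨⟨⟨by linarith, by linarith [hc.2]⟩, h2⟩, by linarith⟩
    · rintro ⟨⟨⟨h0, h1⟩, h2⟩, h3⟩
      rw [hfr (by linarith) (by linarith [hc.2])]
      exact ⟨⟨⟨by linarith [hc.2], by linarith⟩, h2⟩, by linarith⟩
  rw [← measure_inter_add_sdiff _ (measurableSet_Iio (a := 1 - c)), h1, h2, measure_preimage_add,
    measure_preimage_add, measure_inter_add_sdiff _ measurableSet_Ici]

/-- The integer and the fractional part of `N` times a uniform variable are independent and
uniform. -/
lemma volume_Ico_inter_floor_fract {N r : ℕ} (hr : r < N) (T : Set ℝ) :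
    volume (Set.Ico (0 : ℝ) 1 ∩ {w | ⌊N * w⌋₊ = r ∧ Int.fract (N * w) ∈ T}) =
      (N : ENNReal)⁻¹ * volume (Set.Ico (0 : ℝ) 1 ∩ T) := by
  have hN : (0 : ℝ) < N := by exact_mod_cast (Nat.zero_le r).trans_lt hr
  have hr1 : (r : ℝ) + 1 ≤ N := by exact_mod_cast hr
  have h : Set.Ico (0 : ℝ) 1 ∩ {w | ⌊N * w⌋₊ = r ∧ Int.fract (N * w) ∈ T} =
      (fun w : ℝ => N * w) ⁻¹' ((fun w => -(r : ℝ) + w) ⁻¹' (Set.Ico 0 1 ∩ T)) := by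
    ext w
    simp only [Set.mem_inter_iff, Set.mem_Ico, Set.mem_preimage, Set.mem_ofPred_eq]
    have hfr : (r : ℝ) ≤ N * w → N * w < r + 1 → Int.fract (N * w) = -r + N * w := by
      intro h1 h2
      rw [← Int.fract_sub_natCast _ r, Int.fract_eq_self.2 ⟨by linarith, by linarith⟩]
      ring
    constructor
    · rintro ⟨⟨h0, h1⟩, h2, h3⟩
      obtain ⟨h4, h5⟩ := (Nat.floor_eq_iff (by positivity)).1 h2
      rw [hfr h4 h5] at h3
      exact ⟨⟨by linarith, by linarith⟩, h3⟩
    · rintro ⟨⟨h0, h1⟩, h3⟩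
      have h4 : (r : ℝ) ≤ N * w := by linarith
      have h5 : N * w < r + 1 := by linarith
      have hw : 0 ≤ w := by
        by_contra! hw
        nlinarith [Nat.cast_nonneg (α := ℝ) r]
      refine ⟨⟨hw, ?_⟩, (Nat.floor_eq_iff (by positivity)).2 ⟨h4, h5⟩, ?_⟩
      · by_contra! hw1
        nlinarith
      · rwa [hfr h4 h5]
  rw [h, Real.volume_preimage_mul_left hN.ne', measure_preimage_add, abs_of_pos (by positivity),
    ENNReal.ofReal_inv_of_pos hN, ENNReal.ofReal_natCast]

/-! ### Dyadic cells -/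

/-- The index of the dyadic cell of level `k` that contains `x`. -/
noncomputable def dyadicCell (k : ℕ) (x : unitInterval) : ℕ := ⌊2 ^ k * (x : ℝ)⌋₊

lemma measurable_dyadicCell (k : ℕ) : Measurable (dyadicCell k) :=
  Nat.measurable_floor.comp (by fun_prop)

lemma dyadicCell_eq_div (k l : ℕ) (x : unitInterval) :
    dyadicCell k x = dyadicCell (k + l) x / 2 ^ l := by
  unfold dyadicCell
  rw [← Nat.floor_div_natCast]
  congr 1
  push_cast
  rw [pow_add]
  field_simp

lemma dyadicCell_eq_of_le {k l : ℕ} (h : k ≤ l) {x y : unitInterval}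
    (hxy : dyadicCell l x = dyadicCell l y) : dyadicCell k x = dyadicCell k y := by
  obtain ⟨m, rfl⟩ := Nat.exists_eq_add_of_le h
  rw [dyadicCell_eq_div k m, hxy, ← dyadicCell_eq_div]

/-- Once `2 ^ k * (y - x) > 1`, the two integer parts differ. -/
lemma exists_dyadicCell_ne {x y : unitInterval} (hxy : x ≠ y) :
    ∃ k, dyadicCell k x ≠ dyadicCell k y := by
  wlog hlt : x < y generalizing x y
  · obtain ⟨k, hk⟩ := this hxy.symm (lt_of_le_of_ne (not_lt.1 hlt) hxy.symm)
    exact ⟨k, hk.symm⟩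
  have hd : (0 : ℝ) < y - x := sub_pos.2 hlt
  obtain ⟨k, hk⟩ := pow_unbounded_of_one_lt (1 / ((y : ℝ) - x)) (one_lt_two)
  refine ⟨k, ne_of_lt ?_⟩
  rw [div_lt_iff₀ hd] at hk
  have h0 : 0 ≤ 2 ^ k * (x : ℝ) := mul_nonneg (by positivity) x.2.1
  unfold dyadicCell
  refine Nat.lt_of_succ_le (Nat.le_floor ?_)
  push_cast
  have := Nat.floor_le h0
  linarith

lemma exists_dyadicCell_injective {n : ℕ} {x : Fin n → unitInterval} (hx : Function.Injective x) :
    ∃ k, Function.Injective fun i => dyadicCell k (x i) := by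
  classical
  have h : ∀ p : Fin n × Fin n, ∃ k, p.1 ≠ p.2 → dyadicCell k (x p.1) ≠ dyadicCell k (x p.2) := by
    intro p
    by_cases hp : p.1 = p.2
    · exact ⟨0, fun h => absurd hp h⟩
    · obtain ⟨k, hk⟩ := exists_dyadicCell_ne (hx.ne hp)
      exact ⟨k, fun _ => hk⟩
  choose k hk using h
  refine ⟨Finset.univ.sup k, fun i j hij => ?_⟩
  by_contra hne
  exact hk (i, j) hne (dyadicCell_eq_of_le (Finset.le_sup (Finset.mem_univ (i, j))) hij)

/-- The fractional part of `2 ^ k * t` is uniform on each dyadic cell of level `k`. -/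
lemma volume_dyadicCell_inter_fract (k i : ℕ) (A : Set ℝ) :
    volume {t : unitInterval | dyadicCell k t = i ∧ Int.fract (2 ^ k * (t : ℝ)) ∈ A} =
      volume {t : unitInterval | dyadicCell k t = i} * volume (Set.Ico (0 : ℝ) 1 ∩ A) := by
  have hpow : (0 : ℝ) < 2 ^ k := by positivity
  by_cases hi : i < 2 ^ k
  · have hi1 : (i : ℝ) + 1 ≤ 2 ^ k := by exact_mod_cast hi
    have key : ∀ A : Set ℝ,
        volume {t : unitInterval | dyadicCell k t = i ∧ Int.fract (2 ^ k * (t : ℝ)) ∈ A} =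
          ENNReal.ofReal (2 ^ k)⁻¹ * volume (Set.Ico (0 : ℝ) 1 ∩ A) := by
      intro A
      have h : Subtype.val '' {t : unitInterval | dyadicCell k t = i ∧
          Int.fract (2 ^ k * (t : ℝ)) ∈ A} =
          (fun w : ℝ => 2 ^ k * w) ⁻¹' ((fun w => -(i : ℝ) + w) ⁻¹' (Set.Ico 0 1 ∩ A)) := by
        ext w
        simp only [Set.mem_image, Set.mem_inter_iff, Set.mem_Ico, Set.mem_preimage,
          Set.mem_ofPred_eq]
        have hfr : (i : ℝ) ≤ 2 ^ k * w → 2 ^ k * w < i + 1 →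
            Int.fract (2 ^ k * w) = -i + 2 ^ k * w := by
          intro h1 h2
          rw [← Int.fract_sub_natCast _ i, Int.fract_eq_self.2 ⟨by linarith, by linarith⟩]
          ring
        constructor
        · rintro ⟨t, ⟨h2, h3⟩, rfl⟩
          obtain ⟨h4, h5⟩ := (Nat.floor_eq_iff (mul_nonneg hpow.le t.2.1)).1 h2
          rw [hfr h4 h5] at h3
          exact ⟨⟨by linarith, by linarith⟩, h3⟩
        · rintro ⟨⟨h0, h1⟩, h3⟩
          have h4 : (i : ℝ) ≤ 2 ^ k * w := by linarith
          have h5 : 2 ^ k * w < i + 1 := by linarith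
          have hw : 0 ≤ w := by
            by_contra! hw
            nlinarith [Nat.cast_nonneg (α := ℝ) i]
          have hw1 : w ≤ 1 := by
            by_contra! hw1
            nlinarith
          refine ⟨⟨w, hw, hw1⟩, ⟨(Nat.floor_eq_iff (by positivity)).2 ⟨h4, h5⟩, ?_⟩, rfl⟩
          rwa [hfr h4 h5]
      rw [unitInterval.volume_apply, h, Real.volume_preimage_mul_left hpow.ne',
        measure_preimage_add, abs_of_pos (by positivity)]
    have huniv := key Set.univ
    simp only [Set.mem_univ, and_true, Set.inter_univ, Real.volume_Ico, sub_zero,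
      ENNReal.ofReal_one, mul_one] at huniv
    rw [key, huniv]
  -- Only the endpoint `1` can have an index this large, and only for `i = 2 ^ k`.
  · have hnull : volume {t : unitInterval | dyadicCell k t = i} = 0 := by
      refine measure_mono_null (t := {1}) (fun t ht => ?_) (measure_singleton _)
      have h1 : (i : ℝ) ≤ 2 ^ k * t := by
        rw [← (ht : dyadicCell k t = i)]
        exact Nat.floor_le (mul_nonneg hpow.le t.2.1)
      have h2 : (2 : ℝ) ^ k ≤ i := by exact_mod_cast not_lt.1 hi
      have h3 : (1 : ℝ) ≤ t := by
        by_contra! h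
        nlinarith
      exact Subtype.ext (le_antisymm t.2.2 h3)
    rw [hnull, zero_mul]
    exact measure_mono_null (fun t ht => ht.1) hnull

/-! ### Removing one point by means of the positions -/

namespace SimplePointMeasure

/-- The first level at which the points lie in distinct dyadic cells. -/
noncomputable def level (ν : SimplePointMeasure) : ℕ :=
  sInf {k | ∀ i, ν.1 {x | dyadicCell k x = i} ≤ 1}

/-- The sum, modulo one, of the relative positions of the points in their dyadic cells. -/
noncomputable def phase (ν : SimplePointMeasure) : ℝ :=
  Int.fract (∫⁻ x, ENNReal.ofReal (Int.fract (2 ^ level ν * (x : ℝ))) ∂ν.1).toReal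

/-- The rank of the point to be removed. -/
noncomputable def removedRank (ν : SimplePointMeasure) : ℕ :=
  ⌊(ν.1 Set.univ).toReal * phase ν⌋₊

/-- A variable that is uniform and independent of the points left after the removal. -/
noncomputable def residual (ν : SimplePointMeasure) : ℝ :=
  Int.fract ((ν.1 Set.univ).toReal * phase ν)

/-- The indices of the cells that have exactly `removedRank ν` points to their left. -/
def removedCells (ν : SimplePointMeasure) : Set ℕ :=
  {i | ν.1 {x | dyadicCell (level ν) x < i} = removedRank ν}

lemma exists_restrict_eq_sum_dirac (ν : SimplePointMeasure) {s : Set unitInterval}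
    (hs : MeasurableSet s) :
    ∃ A : Finset unitInterval, ν.1.restrict s = ∑ x ∈ A, Measure.dirac x := by
  classical
  obtain ⟨A, hA⟩ := ν.2
  refine ⟨A.filter (· ∈ s), ?_⟩
  ext B hB
  rw [Measure.restrict_apply hB, hA, Measure.finsetSum_apply, Measure.finsetSum_apply,
    Finset.sum_filter]
  refine Finset.sum_congr rfl fun x _ => ?_
  by_cases hx : x ∈ s <;> by_cases hxB : x ∈ B <;> simp [hx, hxB, hB, hs]

/-- Remove the point that has `removedRank ν` points to its left. -/
noncomputable def removePoint (ν : SimplePointMeasure) : SimplePointMeasure :=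
  ⟨ν.1.restrict (dyadicCell (level ν) ⁻¹' (removedCells ν)ᶜ), ν.exists_restrict_eq_sum_dirac
    (measurable_dyadicCell _ (Set.to_countable _).measurableSet)⟩

lemma measurable_level : Measurable level := by
  refine measurable_nat_sInf
    (S := fun k => {ν : SimplePointMeasure | ∀ i, ν.1 {x | dyadicCell k x = i} ≤ 1}) fun k => ?_
  rw [Set.ofPred_forall]
  exact MeasurableSet.iInter fun i =>
    measurable_apply (measurable_dyadicCell k (measurableSet_singleton i)) measurableSet_Iic

lemma measurable_phase : Measurable phase := by
  refine measurable_fract.comp (ENNReal.measurable_toReal.comp ?_)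
  refine measurable_apply_countable (g := fun k (ν : SimplePointMeasure) =>
    ∫⁻ x, ENNReal.ofReal (Int.fract (2 ^ k * (x : ℝ))) ∂ν.1) (fun k => ?_) measurable_level
  refine (Measure.measurable_lintegral ?_).comp measurable_subtype_coe
  fun_prop

lemma measurable_removedRank : Measurable removedRank :=
  Nat.measurable_floor.comp
    ((measurable_apply MeasurableSet.univ).ennreal_toReal.mul measurable_phase)

lemma measurable_residual : Measurable residual :=
  measurable_fract.comp
    ((measurable_apply MeasurableSet.univ).ennreal_toReal.mul measurable_phase)

lemma measurableSet_mem_removedCells (i : ℕ) :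
    MeasurableSet {ν : SimplePointMeasure | i ∈ removedCells ν} := by
  refine measurableSet_eq_fun ?_
    ((measurable_of_countable (Nat.cast : ℕ → ENNReal)).comp measurable_removedRank)
  exact measurable_apply_countable (g := fun k (ν : SimplePointMeasure) =>
    ν.1 {x | dyadicCell k x < i}) (fun k => measurable_apply
      (measurable_dyadicCell k (measurableSet_Iio (a := i)))) measurable_level

lemma measurableSet_dyadicCell_mem_removedCells :
    MeasurableSet {p : SimplePointMeasure × unitInterval |
      dyadicCell (level p.1) p.2 ∈ removedCells p.1} := by
  have hc : Measurable fun p : SimplePointMeasure × unitInterval => dyadicCell (level p.1) p.2 :=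
    measurable_apply_countable (g := fun k (p : SimplePointMeasure × unitInterval) =>
      dyadicCell k p.2) (fun k => (measurable_dyadicCell k).comp measurable_snd)
      (measurable_level.comp measurable_fst)
  have : {p : SimplePointMeasure × unitInterval | dyadicCell (level p.1) p.2 ∈ removedCells p.1} =
      ⋃ i, {p | dyadicCell (level p.1) p.2 = i} ∩ Prod.fst ⁻¹' {ν | i ∈ removedCells ν} := by
    ext p
    simp
  rw [this]
  exact MeasurableSet.iUnion fun i => (hc (measurableSet_singleton i)).inter
    (measurable_fst (measurableSet_mem_removedCells i))

lemma measurable_removePoint : Measurable removePoint := by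
  classical
  refine measurable_of_apply fun B hB => ?_
  have hsum : ∀ ν : SimplePointMeasure, (removePoint ν).1 B =
      ∑' i, if i ∈ removedCells ν then 0 else ν.1 (B ∩ {x | dyadicCell (level ν) x = i}) := by
    intro ν
    have hm : ∀ i, MeasurableSet (B ∩ {x | dyadicCell (level ν) x = i}) := fun i =>
      hB.inter (measurable_dyadicCell _ (measurableSet_singleton i))
    have : B ∩ dyadicCell (level ν) ⁻¹' (removedCells ν)ᶜ =
        ⋃ i, if i ∈ removedCells ν then ∅ else B ∩ {x | dyadicCell (level ν) x = i} := by
      ext x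
      simp only [Set.mem_inter_iff, Set.mem_preimage, Set.mem_compl_iff, Set.mem_iUnion]
      constructor
      · rintro ⟨h1, h2⟩
        exact ⟨_, by rw [if_neg h2]; exact ⟨h1, rfl⟩⟩
      · rintro ⟨i, hi⟩
        split_ifs at hi with h
        · exact absurd hi (Set.notMem_empty x)
        · obtain ⟨h1, rfl⟩ := hi
          exact ⟨h1, h⟩
    rw [removePoint, Measure.restrict_apply hB, this, measure_iUnion]
    · refine tsum_congr fun i => ?_
      split_ifs <;> simp
    · intro i j hij
      refine Set.disjoint_left.2 fun x hx hx' => ?_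
      dsimp only at hx hx'
      split_ifs at hx hx'
      all_goals first | exact hx | exact hx' | exact hij (hx.2.symm.trans hx'.2)
    · intro i
      split_ifs
      · exact MeasurableSet.empty
      · exact hm i
  simp only [hsum]
  refine Measurable.tsum fun i => Measurable.ite (measurableSet_mem_removedCells i)
    measurable_const ?_
  exact measurable_apply_countable (g := fun k (ν : SimplePointMeasure) =>
    ν.1 (B ∩ {x | dyadicCell k x = i})) (fun k => measurable_apply
      (hB.inter (measurable_dyadicCell k (measurableSet_singleton i)))) measurable_level

lemma residual_mem_Ico (ν : SimplePointMeasure) : residual ν ∈ Set.Ico (0 : ℝ) 1 :=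
  ⟨Int.fract_nonneg _, Int.fract_lt_one _⟩

open Classical in
lemma ofPoints_apply_eq_card {n : ℕ} {x : Fin n → unitInterval} (h : Function.Injective x)
    (B : Set unitInterval) :
    (ofPoints x).1 B = (Finset.univ.filter fun i => x i ∈ B).card := by
  rw [ofPoints_apply h, Finset.card_filter]
  push_cast
  exact Finset.sum_congr rfl fun i _ => by simp [Set.indicator_apply]

lemma separated_ofPoints_iff {n : ℕ} {x : Fin n → unitInterval} (h : Function.Injective x)
    (k : ℕ) : (∀ i, (ofPoints x).1 {z | dyadicCell k z = i} ≤ 1) ↔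
      Function.Injective fun j => dyadicCell k (x j) := by
  classical
  simp only [ofPoints_apply_eq_card h, Nat.cast_le_one, Finset.card_le_one, Finset.mem_filter,
    Finset.mem_univ, true_and, Set.mem_ofPred_eq]
  exact ⟨fun H a b hab => H _ a rfl b hab.symm, fun H i a ha b hb => H (ha.trans hb.symm)⟩

lemma level_ofPoints {n : ℕ} {x : Fin n → unitInterval} (h : Function.Injective x) :
    level (ofPoints x) = sInf {k | Function.Injective fun j => dyadicCell k (x j)} := by
  simp only [level, separated_ofPoints_iff h]

lemma dyadicCell_level_injective {n : ℕ} {x : Fin n → unitInterval} (h : Function.Injective x) :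
    Function.Injective fun j => dyadicCell (level (ofPoints x)) (x j) := by
  rw [level_ofPoints h]
  exact Nat.sInf_mem (exists_dyadicCell_injective h)

lemma removedRank_ofPoints_lt {n : ℕ} {x : Fin (n + 1) → unitInterval}
    (h : Function.Injective x) : removedRank (ofPoints x) < n + 1 := by
  rw [removedRank, ofPoints_apply_eq_card h]
  have h1 : phase (ofPoints x) < 1 := Int.fract_lt_one _
  have h0 : 0 ≤ phase (ofPoints x) := Int.fract_nonneg _
  rw [Nat.floor_lt (by positivity)]
  simp only [Set.mem_univ, Finset.filter_true, Finset.card_univ, Fintype.card_fin,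
    ENNReal.toReal_natCast]
  push_cast
  nlinarith [Nat.cast_nonneg (α := ℝ) n]

/-- The points occupy distinct cells, so ranking them by cell is an injection of `Fin (n + 1)` into
itself, hence a bijection, and one point has the prescribed rank. `removedCells` may also contain
empty cells, which is harmless. -/
lemma existsUnique_mem_removedCells {n : ℕ} {x : Fin (n + 1) → unitInterval}
    (h : Function.Injective x) :
    ∃! j, dyadicCell (level (ofPoints x)) (x j) ∈ removedCells (ofPoints x) := by
  classical
  set c : Fin (n + 1) → ℕ := fun j => dyadicCell (level (ofPoints x)) (x j) with hc
  have hcinj : Function.Injective c := dyadicCell_level_injective h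
  have hlt : ∀ j, (Finset.univ.filter fun i => c i < c j).card < n + 1 := fun j => by
    refine (Finset.card_lt_card (t := Finset.univ) ?_).trans_eq (by simp)
    exact ⟨Finset.subset_univ _, fun hs => by simpa using hs (Finset.mem_univ j)⟩
  let ρ : Fin (n + 1) → Fin (n + 1) := fun j => ⟨_, hlt j⟩
  have hmono : ∀ i j, c i < c j → ρ i < ρ j := fun i j hij => by
    change (Finset.univ.filter fun l => c l < c i).card <
      (Finset.univ.filter fun l => c l < c j).card
    refine Finset.card_lt_card ⟨fun l hl => ?_, fun hs => ?_⟩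
    · simp only [Finset.mem_filter, Finset.mem_univ, true_and] at hl ⊢
      exact hl.trans hij
    · simpa using hs (Finset.mem_filter.2 ⟨Finset.mem_univ i, hij⟩)
  have hρ : Function.Injective ρ := by
    intro i j hij
    by_contra hne
    rcases lt_or_gt_of_ne (hcinj.ne hne) with hl | hl
    · exact (hmono _ _ hl).ne hij
    · exact (hmono _ _ hl).ne hij.symm
  have hiff : ∀ j, c j ∈ removedCells (ofPoints x) ↔
      ρ j = ⟨removedRank (ofPoints x), removedRank_ofPoints_lt h⟩ := fun j => by
    rw [removedCells, Set.mem_ofPred_eq, ofPoints_apply_eq_card h, Nat.cast_inj, Fin.ext_iff]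
    convert Iff.rfl
    exact Iff.rfl
  obtain ⟨j, hj⟩ := (Finite.injective_iff_surjective.1 hρ)
    ⟨removedRank (ofPoints x), removedRank_ofPoints_lt h⟩
  exact ⟨j, (hiff j).2 hj, fun i hi => hρ (((hiff i).1 hi).trans hj.symm)⟩

lemma removePoint_ofPoints {n : ℕ} {x : Fin (n + 1) → unitInterval} (h : Function.Injective x)
    {j : Fin (n + 1)}
    (hj : dyadicCell (level (ofPoints x)) (x j) ∈ removedCells (ofPoints x)) :
    removePoint (ofPoints x) = ofPoints fun i => x (j.succAbove i) := by
  classical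
  have hu := existsUnique_mem_removedCells h
  apply Subtype.ext
  ext B hB
  rw [removePoint, Measure.restrict_apply hB, ofPoints_apply h,
    ofPoints_apply (x := fun i => x (j.succAbove i)) (h.comp Fin.succAbove_right_injective),
    Fin.sum_univ_succAbove _ j]
  rw [Set.indicator_of_notMem (fun hmem => hmem.2 hj), zero_add]
  refine Finset.sum_congr rfl fun i _ => ?_
  have hi : dyadicCell (level (ofPoints x)) (x (j.succAbove i)) ∉ removedCells (ofPoints x) :=
    fun hi => Fin.succAbove_ne j i (hu.unique hi hj)
  by_cases hB' : x (j.succAbove i) ∈ B <;> simp [hB', hi]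

/-- Moving the index `j` to the front is a permutation; this reduces the removal of any point to
that of the first. -/
lemma injective_cons_succAbove_iff {n : ℕ} (x : Fin (n + 1) → unitInterval) (j : Fin (n + 1)) :
    Function.Injective (Fin.cons (x j) fun i => x (j.succAbove i) : Fin (n + 1) → unitInterval) ↔
      Function.Injective x := by
  let σ : Fin (n + 1) → Fin (n + 1) := Fin.cons j j.succAbove
  have hσ : Function.Bijective σ := Finite.injective_iff_bijective.1
    (Fin.cons_injective_iff.2 ⟨by simp, Fin.succAbove_right_injective⟩)
  have : (Fin.cons (x j) fun i => x (j.succAbove i) : Fin (n + 1) → unitInterval) = x ∘ σ := by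
    funext i
    refine Fin.cases ?_ (fun i => ?_) i <;> simp [σ]
  rw [this, Function.Injective.of_comp_iff' x hσ]

lemma ofPoints_cons_succAbove {n : ℕ} {x : Fin (n + 1) → unitInterval}
    (h : Function.Injective x) (j : Fin (n + 1)) :
    ofPoints (Fin.cons (x j) fun i => x (j.succAbove i) : Fin (n + 1) → unitInterval) =
      ofPoints x := by
  apply Subtype.ext
  rw [ofPoints_val h, ofPoints_val ((injective_cons_succAbove_iff x j).2 h),
    Fin.sum_univ_succAbove (fun i => Measure.dirac (x i)) j, Fin.sum_univ_succ]
  simp only [Fin.cons_zero, Fin.cons_succ]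

end SimplePointMeasure

/-! ### Law of the remaining points and of the residual -/

namespace SimplePointMeasure

lemma phase_ofPoints_cons {n : ℕ} {t : unitInterval} {y : Fin n → unitInterval}
    (h : Function.Injective (Fin.cons t y : Fin (n + 1) → unitInterval)) {k : ℕ}
    (hk : level (ofPoints (Fin.cons t y : Fin (n + 1) → unitInterval)) = k) :
    phase (ofPoints (Fin.cons t y : Fin (n + 1) → unitInterval)) =
      Int.fract ((∑ i, Int.fract (2 ^ k * (y i : ℝ))) + Int.fract (2 ^ k * (t : ℝ))) := by
  rw [phase, hk, ofPoints_val h, lintegral_finsetSum_measure]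
  simp only [lintegral_dirac]
  rw [ENNReal.toReal_sum fun _ _ => ENNReal.ofReal_ne_top]
  simp only [ENNReal.toReal_ofReal (Int.fract_nonneg _), Fin.sum_univ_succ, Fin.cons_zero,
    Fin.cons_succ]
  rw [add_comm]

/-- Given the other points `y`, a uniform point `t` is the one removed with probability
`1 / (n + 1)`, and then the residual variable is uniform. -/
lemma volume_removed {n : ℕ} {y : Fin n → unitInterval} (hy : Function.Injective y) {T : Set ℝ}
    (hT : MeasurableSet T) :
    volume {t : unitInterval | Function.Injective (Fin.cons t y : Fin (n + 1) → unitInterval) ∧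
      dyadicCell (level (ofPoints (Fin.cons t y : Fin (n + 1) → unitInterval))) t ∈
        removedCells (ofPoints (Fin.cons t y : Fin (n + 1) → unitInterval)) ∧
      residual (ofPoints (Fin.cons t y : Fin (n + 1) → unitInterval)) ∈ T} =
      ((n + 1 : ℕ) : ENNReal)⁻¹ * volume (Set.Ico (0 : ℝ) 1 ∩ T) := by
  classical
  let x : unitInterval → Fin (n + 1) → unitInterval := fun t => Fin.cons t y
  let z : unitInterval → SimplePointMeasure := fun t => ofPoints (x t)
  let E : Set unitInterval := {t | Function.Injective (x t) ∧
      dyadicCell (level (z t)) t ∈ removedCells (z t) ∧ residual (z t) ∈ T}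
  change volume E = _
  -- Positions of `t` are classified by the level of the whole configuration and the cell of `t` at
  -- that level.
  let W : ℕ × ℕ → Set unitInterval := fun p =>
    {t | Function.Injective (x t) ∧ level (z t) = p.1 ∧ dyadicCell p.1 t = p.2}
  have hinj : ∀ t, Function.Injective (x t) ↔ t ∉ Set.range y := fun t =>
    Fin.cons_injective_iff.trans (and_iff_left hy)
  have hsep : ∀ k t, Function.Injective (fun j => dyadicCell k (x t j)) ↔
      dyadicCell k t ∉ Set.range (fun i => dyadicCell k (y i)) ∧
        Function.Injective fun i => dyadicCell k (y i) := by
    intro k t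
    rw [← Fin.cons_injective_iff]
    refine iff_of_eq (congrArg _ (funext fun j => ?_))
    refine Fin.cases ?_ (fun i => ?_) j <;> simp [x]
  -- Moving `t` within its cell keeps the level: separation at levels up to `k` depends on `t` only
  -- through its cell. Hence each nonempty class is a full cell.
  have hlevel : ∀ k t t', t ∉ Set.range y → level (z t) = k → dyadicCell k t = dyadicCell k t' →
      t' ∉ Set.range y ∧ level (z t') = k := by
    intro k t t' ht hk hc
    have hti := (hinj t).2 ht
    have hspec : Function.Injective (fun j => dyadicCell k (x t j)) := by
      rw [← hk]; exact dyadicCell_level_injective hti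
    have ht' : t' ∉ Set.range y := by
      rintro ⟨i, rfl⟩
      exact ((hsep k t).1 hspec).1 ⟨i, hc.symm⟩
    refine ⟨ht', ?_⟩
    have hti' := (hinj t').2 ht'
    have hcong : ∀ l ≤ k, (Function.Injective (fun j => dyadicCell l (x t j)) ↔
        Function.Injective (fun j => dyadicCell l (x t' j))) := by
      intro l hl
      rw [hsep, hsep, dyadicCell_eq_of_le hl hc]
    have hmem' : k ∈ {k | Function.Injective fun j => dyadicCell k (x t' j)} :=
      (hcong k le_rfl).1 hspec
    change level (ofPoints (x t')) = k
    rw [level_ofPoints hti']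
    refine le_antisymm (Nat.sInf_le hmem') (le_csInf ⟨k, hmem'⟩ fun l hl => ?_)
    by_contra! hlt
    have := Nat.sInf_le (s := {k | Function.Injective fun j => dyadicCell k (x t j)})
      ((hcong l hlt.le).2 hl)
    rw [← level_ofPoints hti] at this
    change level (z t) ≤ l at this
    omega
  have hWcell : ∀ p, (W p).Nonempty → W p = {t | dyadicCell p.1 t = p.2} := by
    rintro p ⟨t, ht, hk, hc⟩
    ext t'
    refine ⟨fun h => h.2.2, fun h => ?_⟩
    obtain ⟨h1, h2⟩ := hlevel p.1 t t' ((hinj t).1 ht) hk (hc.trans (h : _ = p.2).symm)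
    exact ⟨(hinj t').2 h1, h2, h⟩
  have hWmeas : ∀ p, MeasurableSet (W p) := by
    intro p
    rcases (W p).eq_empty_or_nonempty with h | h
    · rw [h]; exact MeasurableSet.empty
    · rw [hWcell p h]
      exact measurable_dyadicCell p.1 (measurableSet_singleton p.2)
  have hWdisj : Pairwise (Function.onFun Disjoint W) := by
    intro p q hpq
    refine Set.disjoint_left.2 fun t hp hq => hpq ?_
    have h1 : p.1 = q.1 := hp.2.1.symm.trans hq.2.1
    refine Prod.ext h1 ?_
    rw [← hp.2.2, ← hq.2.2, h1]
  -- Within a class the phase is the uniform variable `Int.fract (2 ^ k * t)` shifted modulo one by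
  -- a constant, and `t` is removed exactly when the removed rank equals the number `r` of other
  -- points in cells to its left.
  let A : ℕ → ℕ → Set ℝ := fun k r => {u | ⌊((n + 1 : ℕ) : ℝ) *
      Int.fract ((∑ i, Int.fract (2 ^ k * (y i : ℝ))) + u)⌋₊ = r ∧
    Int.fract (((n + 1 : ℕ) : ℝ) *
      Int.fract ((∑ i, Int.fract (2 ^ k * (y i : ℝ))) + u)) ∈ T}
  have hA : ∀ k r, MeasurableSet (A k r) := by
    intro k r
    have hm : Measurable fun u : ℝ => ((n + 1 : ℕ) : ℝ) *
      Int.fract ((∑ i, Int.fract (2 ^ k * (y i : ℝ))) + u) := by fun_prop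
    exact (Nat.measurable_floor.comp hm (measurableSet_singleton r)).inter
      (measurable_fract.comp hm hT)
  have hEW : ∀ p, ∃ r < n + 1, E ∩ W p =
      W p ∩ {t | Int.fract (2 ^ p.1 * (t : ℝ)) ∈ A p.1 r} := by
    intro p
    let r := (Finset.univ.filter fun i => dyadicCell p.1 (y i) < p.2).card
    have hr : r < n + 1 := Nat.lt_succ_of_le ((Finset.card_le_univ _).trans_eq (by simp))
    refine ⟨r, hr, ?_⟩
    rw [Set.inter_comm]
    ext t
    refine and_congr_right fun ⟨ht, hk, hc⟩ => ?_
    have huniv : ((z t).1 Set.univ).toReal = ((n + 1 : ℕ) : ℝ) := by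
      rw [ofPoints_apply_eq_card ht, ENNReal.toReal_natCast]
      simp
    have hphase : phase (z t) = _ := phase_ofPoints_cons ht hk
    have hcells : dyadicCell (level (z t)) t ∈ removedCells (z t) ↔ removedRank (z t) = r := by
      rw [hk, hc, removedCells, Set.mem_ofPred_eq, hk, ofPoints_apply_eq_card ht, Nat.cast_inj,
        eq_comm]
      refine Eq.congr rfl ?_
      rw [Finset.card_filter, Fin.sum_univ_succ]
      simp only [r, Finset.card_filter]
      simp [x, hc]
    change (_ ∧ _ ∧ _) ↔ _
    rw [hcells, removedRank, residual, huniv, hphase]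
    exact ⟨fun h => h.2, fun h => ⟨ht, h⟩⟩
  have hterm : ∀ p, volume (E ∩ W p) =
      volume (W p) * (((n + 1 : ℕ) : ENNReal)⁻¹ * volume (Set.Ico (0 : ℝ) 1 ∩ T)) := by
    intro p
    obtain ⟨r, hr, h⟩ := hEW p
    rcases (W p).eq_empty_or_nonempty with hW | hW
    · simp [hW]
    · rw [h, hWcell p hW]
      refine (volume_dyadicCell_inter_fract p.1 p.2 (A p.1 r)).trans ?_
      congr 1
      rw [← volume_Ico_inter_floor_fract hr]
      exact volume_Ico_inter_preimage_fract_add (∑ i, Int.fract (2 ^ p.1 * (y i : ℝ)))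
        {w | ⌊((n + 1 : ℕ) : ℝ) * w⌋₊ = r ∧ Int.fract (((n + 1 : ℕ) : ℝ) * w) ∈ T}
  have hcover : ⋃ p, W p = (Set.range y)ᶜ := by
    ext t
    simp only [Set.mem_iUnion, Set.mem_compl_iff]
    constructor
    · rintro ⟨p, ht, -⟩
      exact (hinj t).1 ht
    · exact fun ht => ⟨(level (z t), dyadicCell (level (z t)) t), (hinj t).2 ht, rfl, rfl⟩
  have hone : ∑' p, volume (W p) = 1 := by
    rw [← measure_iUnion hWdisj hWmeas, hcover]
    rw [prob_compl_eq_one_iff (Set.finite_range y).measurableSet]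
    exact (Set.finite_range y).measure_zero _
  have hE : E = ⋃ p, E ∩ W p := by
    rw [← Set.inter_iUnion, hcover, Set.inter_eq_left.2]
    exact fun t ht => (hinj t).1 ht.1
  rw [hE, measure_iUnion]
  · simp only [hterm]
    rw [ENNReal.tsum_mul_right, hone, one_mul]
  · exact fun p q hpq => (hWdisj hpq).mono Set.inter_subset_right Set.inter_subset_right
  · intro p
    obtain ⟨r, -, h⟩ := hEW p
    rw [h]
    refine (hWmeas p).inter ?_
    have hm : Measurable fun t : unitInterval => Int.fract (2 ^ p.1 * (t : ℝ)) := by fun_prop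
    exact hm (hA p.1 r)

/-- Removing a point of `n + 1` uniform points leaves `n` uniform points, and an independent
uniform variable. -/
lemma uniformLaw_removePoint_residual (n : ℕ) {S : Set SimplePointMeasure} (hS : MeasurableSet S)
    {T : Set ℝ} (hT : MeasurableSet T) :
    uniformLaw (n + 1) (removePoint ⁻¹' S ∩ residual ⁻¹' T) =
      uniformLaw n S * volume (Set.Ico (0 : ℝ) 1 ∩ T) := by
  let c : unitInterval × (Fin n → unitInterval) → Fin (n + 1) → unitInterval :=
    fun p => Fin.cons p.1 p.2
  have hc : Measurable c := by
    refine measurable_pi_lambda _ fun j => ?_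
    refine Fin.cases ?_ (fun i => ?_) j
    · exact measurable_fst
    · exact (measurable_pi_apply i).comp measurable_snd
  let E : Set (unitInterval × (Fin n → unitInterval)) := {p | ofPoints p.2 ∈ S ∧
    Function.Injective (c p) ∧
    dyadicCell (level (ofPoints (c p))) p.1 ∈ removedCells (ofPoints (c p)) ∧
    residual (ofPoints (c p)) ∈ T}
  have hcp : Measurable fun p => ofPoints (c p) := (measurable_ofPoints _).comp hc
  have hE : MeasurableSet E := by
    refine ((measurable_ofPoints n).comp measurable_snd hS).inter
      ((hc (measurableSet_injective _)).inter (MeasurableSet.inter ?_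
        (measurable_residual.comp hcp hT)))
    exact (hcp.prodMk measurable_fst) measurableSet_dyadicCell_mem_removedCells
  have hvolE : volume E = uniformLaw n S *
      (((n + 1 : ℕ) : ENNReal)⁻¹ * volume (Set.Ico (0 : ℝ) 1 ∩ T)) := by
    rw [Measure.volume_eq_prod, Measure.prod_apply_symm hE, uniformLaw,
      Measure.map_apply (measurable_ofPoints n) hS, mul_comm,
      ← lintegral_indicator_const (measurable_ofPoints n hS)]
    refine lintegral_congr_ae ?_
    filter_upwards [ae_injective_unitInterval n] with y hy
    by_cases hyS : y ∈ ofPoints ⁻¹' S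
    · rw [Set.indicator_of_mem hyS, ← volume_removed hy hT]
      congr 1
      ext t
      exact and_iff_right hyS
    · rw [Set.indicator_of_notMem hyS]
      convert measure_empty (μ := volume)
      ext t
      exact iff_of_false (fun h => hyS h.1) (Set.notMem_empty t)
  -- `F j` is the event with the `j`-th point removed. These `n + 1` events are disjoint, of equal
  -- volume, and cancel the factor `1 / (n + 1)`.
  let F : Fin (n + 1) → Set (Fin (n + 1) → unitInterval) := fun j =>
    MeasurableEquiv.piFinSuccAbove (fun _ => unitInterval) j ⁻¹' E
  have hFmem : ∀ j x, x ∈ F j ↔ Function.Injective x ∧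
      (ofPoints fun i => x (j.succAbove i)) ∈ S ∧
      dyadicCell (level (ofPoints x)) (x j) ∈ removedCells (ofPoints x) ∧
      residual (ofPoints x) ∈ T := by
    intro j x
    have h1 : x ∈ F j ↔ (ofPoints fun i => x (j.succAbove i)) ∈ S ∧
        Function.Injective (Fin.cons (x j) fun i => x (j.succAbove i) :
          Fin (n + 1) → unitInterval) ∧
        dyadicCell (level (ofPoints (Fin.cons (x j) fun i => x (j.succAbove i) :
          Fin (n + 1) → unitInterval))) (x j) ∈ removedCells (ofPoints (Fin.cons (x j)
            fun i => x (j.succAbove i) : Fin (n + 1) → unitInterval)) ∧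
        residual (ofPoints (Fin.cons (x j) fun i => x (j.succAbove i) :
          Fin (n + 1) → unitInterval)) ∈ T := Iff.rfl
    rw [h1, injective_cons_succAbove_iff, and_left_comm]
    refine and_congr_right fun hx => ?_
    rw [ofPoints_cons_succAbove hx]
  have hFvol : ∀ j, volume (F j) = volume E := fun j =>
    (volume_preserving_piFinSuccAbove (fun _ => unitInterval) j).measure_preimage
      hE.nullMeasurableSet
  have hFmeas : ∀ j, MeasurableSet (F j) := fun j => (MeasurableEquiv.measurable _) hE
  have hFdisj : Pairwise (Function.onFun Disjoint F) := by
    intro i j hij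
    refine Set.disjoint_left.2 fun x hi hj => hij ?_
    rw [hFmem] at hi hj
    exact (existsUnique_mem_removedCells hi.1).unique hi.2.2.1 hj.2.2.1
  have hae : ofPoints ⁻¹' (removePoint ⁻¹' S ∩ residual ⁻¹' T) =ᵐ[volume] ⋃ j, F j := by
    filter_upwards [ae_injective_unitInterval (n + 1)] with x hx
    refine propext ?_
    change (x ∈ ofPoints ⁻¹' (removePoint ⁻¹' S ∩ residual ⁻¹' T)) ↔ x ∈ ⋃ j, F j
    obtain ⟨j, hj, -⟩ := existsUnique_mem_removedCells hx
    simp only [Set.mem_iUnion, hFmem]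
    constructor
    · rintro ⟨h1, h2⟩
      refine ⟨j, hx, ?_, hj, h2⟩
      rw [← removePoint_ofPoints hx hj]
      exact h1
    · rintro ⟨i, -, h1, h2, h3⟩
      refine ⟨?_, h3⟩
      rw [Set.mem_preimage, removePoint_ofPoints hx h2]
      exact h1
  rw [uniformLaw, Measure.map_apply (measurable_ofPoints _)
    ((measurable_removePoint hS).inter (measurable_residual hT)), measure_congr hae,
    measure_iUnion hFdisj hFmeas]
  simp only [hFvol, tsum_fintype, Finset.sum_const, Finset.card_univ, Fintype.card_fin]
  rw [hvolE, nsmul_eq_mul, mul_left_comm, ← mul_assoc ((n + 1 : ℕ) : ENNReal),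
    ENNReal.mul_inv_cancel (by simp) (ENNReal.natCast_ne_top _), one_mul]

lemma map_removePoint_uniformLaw (n : ℕ) :
    (uniformLaw (n + 1)).map removePoint = uniformLaw n := by
  ext S hS
  rw [Measure.map_apply measurable_removePoint hS]
  simpa using uniformLaw_removePoint_residual n hS MeasurableSet.univ

lemma map_iterate_removePoint_uniformLaw (n j : ℕ) :
    (uniformLaw (n + j)).map removePoint^[j] = uniformLaw n := by
  induction j with
  | zero => simp [Measure.map_id]
  | succ j ih =>
    rw [Function.iterate_succ, ← Measure.map_map (measurable_removePoint.iterate j)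
      measurable_removePoint, ← add_assoc, map_removePoint_uniformLaw, ih]

/-- The later removals depend only on the result of the first, from which the residual is
independent. At least one removal is needed, whence `m < n`. -/
lemma uniformLaw_iterate_removePoint_residual {m n : ℕ} (hmn : m < n)
    {S : Set SimplePointMeasure} (hS : MeasurableSet S) {T : Set ℝ} (hT : MeasurableSet T) :
    uniformLaw n (removePoint^[n - m] ⁻¹' S ∩ residual ⁻¹' T) =
      uniformLaw m S * volume (Set.Ico (0 : ℝ) 1 ∩ T) := by
  obtain ⟨j, rfl⟩ : ∃ j, n = m + j + 1 := ⟨n - m - 1, by omega⟩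
  rw [show m + j + 1 - m = j + 1 by omega, Function.iterate_succ, Set.preimage_comp,
    uniformLaw_removePoint_residual _ (measurable_removePoint.iterate j hS) hT,
    ← Measure.map_apply (measurable_removePoint.iterate j) hS, map_iterate_removePoint_uniformLaw]

end SimplePointMeasure

/-! ### The thinning map -/

namespace SimplePointMeasure

lemma exists_finset (ν : SimplePointMeasure) : ∃ A : Finset unitInterval,
    ν.1 = ∑ x ∈ A, Measure.dirac x ∧ ν.points = A ∧ ν.1 Set.univ = A.card := by
  classical
  obtain ⟨A, hA⟩ := ν.2
  refine ⟨A, hA, ?_, by simp [hA, Measure.finsetSum_apply]⟩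
  ext x
  have : ν.1 {x} = if x ∈ A then 1 else 0 := by
    simp [hA, Measure.finsetSum_apply, Set.indicator_apply]
  simp [points, this]

lemma points_removePoint_subset (ν : SimplePointMeasure) :
    (removePoint ν).points ⊆ ν.points := by
  intro x hx
  obtain ⟨A, hA, hpts, -⟩ := ν.exists_finset
  rw [hpts]
  by_contra hxA
  have h0 : ν.1 {x} = 0 := by
    rw [hA, Measure.finsetSum_apply]
    refine Finset.sum_eq_zero fun z hz => ?_
    have : z ≠ x := fun h => hxA (h ▸ hz)
    simp [this]
  have h1 : (removePoint ν).1 {x} ≤ ν.1 {x} := Measure.restrict_le_self _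
  rw [h0, (hx : (removePoint ν).1 {x} = 1)] at h1
  simp at h1

lemma points_iterate_removePoint_subset (ν : SimplePointMeasure) (j : ℕ) :
    (removePoint^[j] ν).points ⊆ ν.points := by
  induction j with
  | zero => exact subset_rfl
  | succ j ih =>
    rw [Function.iterate_succ_apply']
    exact (points_removePoint_subset _).trans ih

/-- Keep all points if there are at most `k` of them; otherwise keep `m n v` points, where `n` is
the number of points and `v` the residual variable. -/
noncomputable def thin (k : ℕ) (m : ℕ → ℝ → ℕ) (ν : SimplePointMeasure) : SimplePointMeasure :=
  if ⌊(ν.1 Set.univ).toReal⌋₊ ≤ k then ν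
  else removePoint^[⌊(ν.1 Set.univ).toReal⌋₊ - m ⌊(ν.1 Set.univ).toReal⌋₊ (residual ν)] ν

lemma measurable_thin (k : ℕ) {m : ℕ → ℝ → ℕ} (hm : ∀ n, Measurable (m n)) :
    Measurable (thin k m) := by
  have hN : Measurable fun ν : SimplePointMeasure => ⌊(ν.1 Set.univ).toReal⌋₊ :=
    Nat.measurable_floor.comp (measurable_apply MeasurableSet.univ).ennreal_toReal
  refine Measurable.ite (hN (measurableSet_Iic (a := k))) measurable_id ?_
  refine measurable_apply_countable (g := fun j (ν : SimplePointMeasure) => removePoint^[j] ν)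
    (fun j => measurable_removePoint.iterate j) (hN.sub ?_)
  exact measurable_apply_countable (g := fun n (ν : SimplePointMeasure) => m n (residual ν))
    (fun n => (hm n).comp measurable_residual) hN

lemma points_thin_subset (k : ℕ) (m : ℕ → ℝ → ℕ) (ν : SimplePointMeasure) :
    (thin k m ν).points ⊆ ν.points := by
  unfold thin
  split_ifs
  · exact subset_rfl
  · exact points_iterate_removePoint_subset _ _

lemma uniformLaw_preimage_thin_of_le {n k : ℕ} (hn : n ≤ k) (m : ℕ → ℝ → ℕ)
    (S : Set SimplePointMeasure) : uniformLaw n (thin k m ⁻¹' S) = uniformLaw n S := by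
  refine measure_congr ?_
  filter_upwards [ae_uniformLaw_univ n] with ν hν
  refine propext ?_
  change thin k m ν ∈ S ↔ ν ∈ S
  simp [thin, hν, hn]

/-- Split by the number `j` of points kept: it is a function of the residual, which is independent
of the `j` uniform survivors. The hypothesis `hlt` ensures that a point is removed. -/
lemma uniformLaw_preimage_thin_of_lt {n k : ℕ} (hn : k < n) {m : ℕ → ℝ → ℕ}
    (hm : Measurable (m n)) (hlt : ∀ v ∈ Set.Ico (0 : ℝ) 1, m n v < n)
    {S : Set SimplePointMeasure} (hS : MeasurableSet S) :
    uniformLaw n (thin k m ⁻¹' S) =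
      ∑' j, uniformLaw j S * volume (Set.Ico (0 : ℝ) 1 ∩ m n ⁻¹' {j}) := by
  have hae : thin k m ⁻¹' S =ᵐ[uniformLaw n]
      ⋃ j, removePoint^[n - j] ⁻¹' S ∩ residual ⁻¹' (m n ⁻¹' {j}) := by
    filter_upwards [ae_uniformLaw_univ n] with ν hν
    refine propext ?_
    change thin k m ν ∈ S ↔ ν ∈ ⋃ j, removePoint^[n - j] ⁻¹' S ∩ residual ⁻¹' (m n ⁻¹' {j})
    simp [thin, hν, not_le.2 hn]
  rw [measure_congr hae, measure_iUnion]
  · refine tsum_congr fun j => ?_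
    by_cases hj : j < n
    · exact uniformLaw_iterate_removePoint_residual hj hS (hm (measurableSet_singleton j))
    · have h1 : residual ⁻¹' (m n ⁻¹' {j}) = ∅ := by
        refine Set.eq_empty_of_forall_notMem fun ν hν => hj ?_
        rw [← (hν : m n (residual ν) = j)]
        exact hlt _ (residual_mem_Ico ν)
      have h2 : Set.Ico (0 : ℝ) 1 ∩ m n ⁻¹' {j} = ∅ := by
        refine Set.eq_empty_of_forall_notMem fun v hv => hj ?_
        rw [← (hv.2 : m n v = j)]
        exact hlt _ hv.1
      simp [h1, h2]
  · intro i j hij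
    refine Set.disjoint_left.2 fun ν hi hj => hij ?_
    exact (hi.2 : m n (residual ν) = i).symm.trans hj.2
  · exact fun j => (measurable_removePoint.iterate _ hS).inter
      (measurable_residual (hm (measurableSet_singleton j)))

end SimplePointMeasure

open SimplePointMeasure

/-! ### Existence of a thinning from `mu + 1` -/

/-- The coupling gives the right law of the count, and given the count the remaining points are
uniform. -/
lemma exists_isThinning {a b : ℝ} (ha : 0 < a) (hb : 0 < b) {k : ℕ}
    (hk : ∀ n ≤ k, poissonWeight b n ≤ poissonWeight a n)
    (hF : ∀ n > k, ∑ i ∈ Finset.range (n + 1), poissonWeight b i ≤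
      ∑ i ∈ Finset.range n, poissonWeight a i) :
    ∃ f, IsThinning f b a := by
  obtain ⟨m, hm, hlt, hsum⟩ := exists_poisson_coupling ha hb hk hF
  have hf := measurable_thin k hm
  have hlaw : (poissonLaw b).map (thin k m) = poissonLaw a := by
    ext S hS
    rw [Measure.map_apply hf hS, poissonLaw_apply b (hf hS), poissonLaw_apply a hS]
    simp only [hsum, add_mul]
    rw [ENNReal.tsum_add, ← (ENNReal.summable).sum_add_tsum_nat_add' (k := k + 1)]
    congr 1
    · rw [tsum_eq_sum (s := Finset.range (k + 1))]
      · refine Finset.sum_congr rfl fun n hn => ?_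
        have hn' : n ≤ k := Nat.lt_succ_iff.1 (Finset.mem_range.1 hn)
        rw [uniformLaw_preimage_thin_of_le hn', if_pos hn']
      · intro n hn
        rw [if_neg (by simpa [Nat.lt_succ_iff] using hn), zero_mul]
    · simp only [← ENNReal.tsum_mul_right]
      rw [ENNReal.tsum_comm]
      refine tsum_congr fun i => ?_
      rw [add_comm i, uniformLaw_preimage_thin_of_lt (by omega) (hm _) (hlt _ (by omega)) hS,
        ← ENNReal.tsum_mul_left]
      refine tsum_congr fun j => ?_
      rw [mul_assoc, mul_comm (uniformLaw j S)]
  refine ⟨thin k m, hf, fun Ω _ P _ N hN => ⟨?_, Eventually.of_forall fun ω =>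
    points_thin_subset k m (N ω)⟩⟩
  refine (isPoissonProcess_iff_map_eq (hf.comp hN.measurable) ha).2 ?_
  have hNm := hN.measurable
  rw [isPoissonProcess_iff_map_eq hNm hb] at hN
  exact (Measure.map_map hf hNm).symm.trans ((congrArg _ hN).trans hlaw)

/-- With `b - a = 1` the mean value theorem reduces `hF` to comparing the weights of `n` at `mu` and
at an intermediate mean. -/
lemma add_one_mem_thinnableIntensities {mu : ℝ} (hmu : 0 < mu) :
    mu + 1 ∈ thinnableIntensities mu := by
  have hlt : mu < mu + 1 := lt_add_one mu
  obtain ⟨k, hk, hk'⟩ := exists_poissonWeight_crossing hmu hlt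
  refine ⟨hlt, exists_isThinning hmu (hmu.trans hlt) hk fun n hn => ?_⟩
  obtain ⟨c, hc, h⟩ := exists_sum_poissonWeight_eq hlt n
  rw [h, Finset.sum_range_succ]
  have := poissonWeight_le_of_mem_Ioo hmu hc (hk' n hn)
  linarith

/-! ### The lower bound on the critical intensity -/

lemma poissonLaw_univ_lt {t : ℝ} (ht : 0 < t) (k : ℕ) :
    poissonLaw t {ν | ν.1 Set.univ < (k : ENNReal)} =
      ENNReal.ofReal (∑ i ∈ Finset.range k, poissonWeight t i) := by
  have hm : MeasurableSet {ν : SimplePointMeasure | ν.1 Set.univ < (k : ENNReal)} :=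
    measurable_apply MeasurableSet.univ measurableSet_Iio
  rw [poissonLaw_apply t hm, tsum_eq_sum (s := Finset.range k),
    ENNReal.ofReal_sum_of_nonneg fun i _ => (poissonWeight_pos ht i).le]
  · refine Finset.sum_congr rfl fun n hn => ?_
    have : uniformLaw n {ν | ν.1 Set.univ < (k : ENNReal)} = 1 := by
      rw [← mem_ae_iff_prob_eq_one hm]
      filter_upwards [ae_uniformLaw_univ n] with ν hν
      rw [hν]
      exact_mod_cast Finset.mem_range.1 hn
    rw [this, mul_one]
  · intro n hn
    have : uniformLaw n {ν | ν.1 Set.univ < (k : ENNReal)} = 0 := by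
      refine measure_eq_zero_iff_ae_notMem.2 ?_
      filter_upwards [ae_uniformLaw_univ n] with ν hν
      rw [hν]
      simpa using hn
    rw [this, mul_zero]

lemma poissonLaw_eq_of_subset (t : ℝ) {k : ℕ} {S : Set SimplePointMeasure} (hS : MeasurableSet S)
    (h : ∀ ν ∈ S, ν.1 Set.univ = (k : ENNReal)) :
    poissonLaw t S = ENNReal.ofReal (poissonWeight t k) * uniformLaw k S := by
  rw [poissonLaw_apply t hS, tsum_eq_single k]
  intro n hn
  have : uniformLaw n S = 0 := by
    refine measure_eq_zero_iff_ae_notMem.2 ?_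
    filter_upwards [ae_uniformLaw_univ n] with ν hν hνS
    rw [h ν hνS] at hν
    exact hn (by exact_mod_cast hν.symm)
  rw [this, mul_zero]

/-- A thinning must delete at least one point whenever the number of points is more likely at the
larger intensity. -/
lemma IsThinning.sum_poissonWeight_le {f : SimplePointMeasure → SimplePointMeasure} {a b : ℝ}
    (hf : IsThinning f b a) (ha : 0 < a) (hb : 0 < b) {k : ℕ}
    (hk : poissonWeight a k < poissonWeight b k) :
    ∑ i ∈ Finset.range (k + 1), poissonWeight b i ≤ ∑ i ∈ Finset.range k, poissonWeight a i := by
  have := isProbabilityMeasure_poissonLaw hb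
  obtain ⟨hP, hsub⟩ := hf.2 SimplePointMeasure (poissonLaw b) id (isPoissonProcess_poissonLaw hb)
  have hlaw : (poissonLaw b).map f = poissonLaw a :=
    (isPoissonProcess_iff_map_eq hf.1 ha).1 hP
  have hN : ∀ n : ℕ, MeasurableSet {ν : SimplePointMeasure | ν.1 Set.univ = (n : ENNReal)} :=
    fun n => measurable_apply MeasurableSet.univ (measurableSet_singleton _)
  -- Up to a null set, these are the `k`-point configurations from which nothing is deleted.
  let A : Set SimplePointMeasure :=
    {ν | ν.1 Set.univ = (k : ENNReal)} ∩ f ⁻¹' {ν | ν.1 Set.univ = (k : ENNReal)}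
  have hA : MeasurableSet A := (hN k).inter (hf.1 (hN k))
  have hle : poissonLaw b A ≤ poissonLaw a A := by
    rw [← hlaw, Measure.map_apply hf.1 hA]
    refine measure_mono_ae ?_
    filter_upwards [hsub] with ν hν hνA
    have hfix : f ν = ν := by
      obtain ⟨B, hB, hBp, hBc⟩ := ν.exists_finset
      obtain ⟨C, hC, hCp, hCc⟩ := (f ν).exists_finset
      change (f ν).points ⊆ ν.points at hν
      rw [hBp, hCp, Finset.coe_subset] at hν
      have h1 := hBc.symm.trans hνA.1
      have h2 := hCc.symm.trans hνA.2
      have hcard : B.card = C.card := by exact_mod_cast h1.trans h2.symm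
      have hCB := Finset.eq_of_subset_of_card_le hν hcard.le
      exact Subtype.ext (by rw [hB, hC, hCB])
    change f ν ∈ A
    rw [hfix]
    exact hνA
  have hnull : poissonLaw b A = 0 := by
    -- Both masses of `A` are multiples of `uniformLaw k A`; if it were nonzero, cancelling it would
    -- contradict `hk`.
    have hu : uniformLaw k A = 0 := by
      rw [poissonLaw_eq_of_subset b hA fun ν h => h.1,
        poissonLaw_eq_of_subset a hA fun ν h => h.1] at hle
      by_contra hne
      rw [ENNReal.mul_le_mul_iff_left hne (measure_ne_top _ _),
        ENNReal.ofReal_le_ofReal_iff (poissonWeight_pos ha k).le] at hle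
      exact absurd hk (not_lt.2 hle)
    rw [poissonLaw_eq_of_subset b hA fun ν h => h.1, hu, mul_zero]
  have hlt : MeasurableSet {ν : SimplePointMeasure | ν.1 Set.univ < (k : ENNReal)} :=
    measurable_apply MeasurableSet.univ measurableSet_Iio
  rw [← ENNReal.ofReal_le_ofReal_iff (Finset.sum_nonneg fun i _ => (poissonWeight_pos ha i).le),
    ← poissonLaw_univ_lt ha, ← poissonLaw_univ_lt hb, ← hlaw,
    Measure.map_apply hf.1 hlt]
  refine measure_mono_ae ?_
  filter_upwards [hsub, measure_eq_zero_iff_ae_notMem.1 hnull] with ν hν hνA hνk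
  obtain ⟨B, hB, hBp, hBc⟩ := ν.exists_finset
  obtain ⟨C, hC, hCp, hCc⟩ := (f ν).exists_finset
  change (f ν).points ⊆ ν.points at hν
  rw [hBp, hCp, Finset.coe_subset] at hν
  change ν.1 Set.univ < ((k + 1 : ℕ) : ENNReal) at hνk
  change (f ν).1 Set.univ < (k : ENNReal)
  rw [hBc, Nat.cast_lt] at hνk
  rw [hCc, Nat.cast_lt]
  have hcard := Finset.card_le_card hν
  by_contra hge
  refine hνA ⟨?_, ?_⟩
  · change ν.1 Set.univ = (k : ENNReal)
    rw [hBc]; congr 1; omega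
  · change (f ν).1 Set.univ = (k : ENNReal)
    rw [hCc]; congr 1; omega

/-- The test count `⌈lam⌉₊` is at least `lam`, so its weight is larger at `lam` than at `mu`. If the
bound failed, it would also be below `mu + 2`, so its weight would vary by a factor at most `exp (2
/ mu)` between `mu` and `lam`. -/
lemma add_exp_le_of_mem_thinnableIntensities {mu lam : ℝ} (hmu : 0 < mu)
    (h : lam ∈ thinnableIntensities mu) : mu + Real.exp (-(2 / mu)) ≤ lam := by
  obtain ⟨hlt, f, hf⟩ := h
  by_contra! hcon
  have hexp : Real.exp (-(2 / mu)) ≤ 1 := Real.exp_le_one_iff.2 (by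
    have : 0 < 2 / mu := by positivity
    linarith)
  have hlam : 0 < lam := hmu.trans hlt
  have hk : poissonWeight mu ⌈lam⌉₊ < poissonWeight lam ⌈lam⌉₊ :=
    poissonWeight_lt_of_le hmu hlt (Nat.le_ceil lam)
  have hsum := hf.sum_poissonWeight_le hmu hlam hk
  obtain ⟨c, hc, hc'⟩ := exists_sum_poissonWeight_eq hlt ⌈lam⌉₊
  rw [hc', Finset.sum_range_succ] at hsum
  have hceil : (⌈lam⌉₊ : ℝ) < lam + 1 := Nat.ceil_lt_add_one hlam.le
  have hbound := poissonWeight_le_exp_mul hmu hc.1 (by linarith [hc.2]) (n := ⌈lam⌉₊)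
    (by linarith)
  have hpos := poissonWeight_pos hmu ⌈lam⌉₊
  have h1 : poissonWeight mu ⌈lam⌉₊ ≤
      (lam - mu) * (Real.exp (2 / mu) * poissonWeight mu ⌈lam⌉₊) :=
    le_trans (by linarith) (mul_le_mul_of_nonneg_left hbound (sub_nonneg.2 hlt.le))
  have h2 : (lam - mu) * (Real.exp (2 / mu) * poissonWeight mu ⌈lam⌉₊) <
      Real.exp (-(2 / mu)) * (Real.exp (2 / mu) * poissonWeight mu ⌈lam⌉₊) :=
    mul_lt_mul_of_pos_right (by linarith) (by positivity)
  rw [← mul_assoc (Real.exp (-(2 / mu))), ← Real.exp_add, neg_add_cancel, Real.exp_zero,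
    one_mul] at h2
  linarith

theorem mainTheorem3 :
    (∀ mu : ℝ, 0 < mu →
      (thinnableIntensities mu).Nonempty ∧ criticalIntensity mu ≤ mu + 1) ∧
    ∃ r : ℝ → ℝ, r =o[atTop] (fun _ => (1 : ℝ)) ∧
      ∀ᶠ mu : ℝ in atTop, mu + 1 - r mu ≤ criticalIntensity mu := by
  refine ⟨fun mu hmu => ⟨⟨_, add_one_mem_thinnableIntensities hmu⟩,
    csInf_le ⟨mu, fun lam h => h.1.le⟩ (add_one_mem_thinnableIntensities hmu)⟩,
    fun mu => 1 - Real.exp (-(2 / mu)), ?_, ?_⟩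
  · rw [isLittleO_one_iff]
    have h : Tendsto (fun mu : ℝ => -(2 / mu)) atTop (nhds 0) := by
      simpa using ((tendsto_const_nhds (x := (2 : ℝ))).div_atTop tendsto_id).neg
    simpa using ((Real.continuous_exp.tendsto 0).comp h).const_sub 1
  · filter_upwards [eventually_gt_atTop 0] with mu hmu
    refine le_csInf ⟨_, add_one_mem_thinnableIntensities hmu⟩ fun lam h => ?_
    linarith [add_exp_le_of_mem_thinnableIntensities hmu h]
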